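/- All logarithms are to base $2$. For $x\in\mathbb R$ and $b\ge 0$ let $[x]_b=\lfloor x\rfloor+\sum_{i=1}^b 2^{-i}a_i$, where $0.a_1a_2\ldots$ is the (terminating, if there is a choice) binary expansion of $x-\lfloor x\rfloor$; for vectors, $[\cdot]_b$ acts componentwise. Let $\mathcal X\subset\mathbb R$ be bounded and $\mathcal X_b=\{[x]_b:x\in\mathcal X\}$. Let $\mathbf X=\{X_i\}_{i\ge 1}$ be a stationary process with alphabet $\mathcal X$ that is $\Psi^*$-mixing, i.e. $\lim_{g\to\infty}\psi^*(g)=1$, where $\psi^*(g)=\sup \frac{\mathbb P(\mathcal A\cap\mathcal B)}{\mathbb P(\mathcal A)\mathbb P(\mathcal B)}$ over all $j\ge1$, $\mathcal A\in\sigma(X_i:i\le j)$, $\mathcal B\in\sigma(X_i:i\ge j+g)$ with $\mathbb P(\mathcal A)\mathbb P(\mathcal B)>0$. Let $\bar d_o(\mathbf X)=\lim_{k\to\infty}\limsup_{b\to\infty}\frac1b H([X_{k+1}]_b\mid[X^k]_b)$ be its upper information dimension. Let $r>1$, $\delta>0$, $b=b_n=\lfloor r\log\log n\rfloor$, $\lambda=\lambda_n=(\log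 n)^{2r}$, let $k=k_n\to\infty$ be integers with $k_n=o\big(\frac{\log n}{\log\log n}\big)$, and let $m=m_n$ be integers with $m_n\ge(1+\delta)\,\bar d_o(\mathbf X)\,n$ and $m_n\ge c\,n$ for all large $n$, for some constant $c>0$ (the second condition is automatic if $\bar d_o(\mathbf X)>0$). For each $n$ let $A=A_n\in\mathbb R^{m\times n}$ be a random matrix with i.i.d. $\mathcal N(0,1)$ entries, independent of $X^n=(X_1,\dots,X_n)$, and let $Y^m=AX^n$. For a sequence $u^n$ let $\hat p_{k+1}(a^{k+1}|u^n)=\frac{1}{n-k-1}\big|\{i: k+2\le i\le n,\ u_{i-k-1}^{i-1}=a^{k+1}\}\big|$, and let $\hat p_{k+1}(a_{k+1}|a^k)=\hat p_{k+1}(a^{k+1}|u^n)/\sum_{c}\hat p_{k+1}(a^kc|u^n)$ be the induced conditional probabilities. For weights $\mathbf w=(w_{a^{k+1}})_{a^{k+1}\in\mathcal X_b^{k+1}}$ with values in $[0,+\infty]$ let $c_{\mathbf w}(u^n)=\sum_{a^{k+1}\in\mathcal X_b^{k+1}}w_{a^{k+1}}\,\hat p_{k+1}(a^{k+1}|u^n)$,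 with $\infty\cdot 0=0$. Let $\mathbf W^*_n$ be the weights $W^*_{a^{k+1}}=-\log\hat p_{k+1}(a_{k+1}|a^k)$ computed from $u^n=[X^n]_b$, with $W^*_{a^{k+1}}=+\infty$ if $a^{k+1}$ does not occur, i.e. if $\hat p_{k+1}(a^{k+1}|[X^n]_b)=0$. Let $\mathbf W_n$ be random weights with values in $[0,+\infty]$, possibly depending on $X^n$ and $A$, such that for every $\epsilon>0$ $$\mathbb P\Big(\tfrac1b\|\mathbf W_n-\mathbf W_n^*\|_\infty>\epsilon\Big)\to0\qquad(n\to\infty),$$ where $|\infty-\infty|=0$ and $|\infty-x|=\infty$ for $x<\infty$. Let $\hat X^n$ be any minimizer over $u^n\in\mathcal X_b^n$ of $c_{\mathbf W_n}(u^n)+\frac{\lambda}{n^2}\|Au^n-Y^m\|_2^2$. Then $$\frac1{\sqrt n}\|X^n-\hat X^n\|_2\to0\quad\text{in probability as }n\to\infty.$$ -/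

import Mathlib

open MeasureTheory ProbabilityTheory Filter Topology Asymptotics
open scoped ENNReal NNReal

namespace AMEP

noncomputable section

/-- The `i`-th binary digit `aᵢ` (`i ≥ 1`) of the fractional part `x - ⌊x⌋ = 0.a₁a₂…`. -/
def binDigit (x : ℝ) (i : ℕ) : ℤ := ⌊(2 : ℝ) ^ i * Int.fract x⌋ % 2

/-- The `b`-bit quantization `[x]_b = ⌊x⌋ + ∑_{i=1}^b 2^{-i} aᵢ`. -/
def quantize (b : ℕ) (x : ℝ) : ℝ :=
  (⌊x⌋ : ℝ) + ∑ i ∈ Finset.Icc 1 b, ((2 : ℝ) ^ i)⁻¹ * (binDigit x i : ℝ)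

theorem quantize_eq (b : ℕ) (x : ℝ) :
    quantize b x = (⌊(2 : ℝ) ^ b * x⌋ : ℝ) / 2 ^ b := by
  induction b with
  | zero => simp [quantize]
  | succ b ih =>
    have h1 : quantize (b + 1) x
        = quantize b x + ((2 : ℝ) ^ (b + 1))⁻¹ * (binDigit x (b + 1) : ℝ) := by
      unfold quantize
      rw [Finset.sum_Icc_succ_top (by omega)]
      ring
    have h2 : ⌊(2 : ℝ) ^ (b + 1) * Int.fract x⌋
        = ⌊(2 : ℝ) ^ (b + 1) * x⌋ - 2 ^ (b + 1) * ⌊x⌋ := by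
      rw [← Int.floor_sub_intCast]
      congr 1
      rw [Int.fract]
      push_cast
      ring
    have h3 : binDigit x (b + 1) = ⌊(2 : ℝ) ^ (b + 1) * x⌋ % 2 := by
      unfold binDigit
      rw [h2, show (2 : ℤ) ^ (b + 1) * ⌊x⌋ = 2 * (2 ^ b * ⌊x⌋) by ring]
      omega
    have h4 : ⌊(2 : ℝ) ^ (b + 1) * x⌋ / 2 = ⌊(2 : ℝ) ^ b * x⌋ := by
      have e : (2 : ℝ) ^ (b + 1) * x = 2 * ((2 : ℝ) ^ b * x) := by ring
      rw [e]
      generalize (2 : ℝ) ^ b * x = y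
      have l1 : 2 * ⌊y⌋ ≤ ⌊2 * y⌋ := by
        rw [Int.le_floor]; push_cast; linarith [Int.floor_le y]
      have l2 : ⌊2 * y⌋ < 2 * ⌊y⌋ + 2 := by
        rw [Int.floor_lt]; push_cast; linarith [Int.lt_floor_add_one y]
      omega
    have h5 : (⌊(2 : ℝ) ^ (b + 1) * x⌋ : ℝ)
        = 2 * (⌊(2 : ℝ) ^ b * x⌋ : ℝ) + (binDigit x (b + 1) : ℝ) := by
      rw [h3, ← h4]
      exact_mod_cast (Int.mul_ediv_add_emod _ 2).symm
    rw [h1, ih, h5, pow_succ]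
    field_simp

/-- The quantized alphabet `𝒳_b = {[x]_b : x ∈ 𝒳}`. -/
def quantAlphabet (𝒳 : Set ℝ) (b : ℕ) : Set ℝ := quantize b '' 𝒳

/-- The componentwise quantization `[x^n]_b`. -/
def quantVec {n : ℕ} (b : ℕ) (x : Fin n → ℝ) : Fin n → ℝ := fun i => quantize b (x i)

/-- The `k`-th order empirical distribution
`p̂_k(a^k | u^n) = |{i : u_{i-k}^{i-1} = a^k, k+1 ≤ i ≤ n}| / (n - k)`.
With sequences indexed from `0`, the window belonging to `i` starts at position
`j = i - k - 1 < n - k`. -/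
def empDist (k : ℕ) {n : ℕ} (u : Fin n → ℝ) (a : Fin k → ℝ) : ℝ :=
  (Nat.card {j : Fin (n - k) // ∀ t : Fin k, u ⟨j + t, by omega⟩ = a t} : ℝ) / ((n - k : ℕ) : ℝ)

/-- The conditional empirical probability `p̂_{k+1}(a_{k+1} | a^k)` induced by
`p̂_{k+1}(· | u^n)`. The sum over the last symbol has finitely many nonzero terms; the value is
`0` when the context `a^k` has zero empirical mass. -/
def condEmpDist (k : ℕ) {n : ℕ} (u : Fin n → ℝ) (a : Fin (k + 1) → ℝ) : ℝ :=
  empDist (k + 1) u a / ∑' c : ℝ, empDist (k + 1) u (Fin.snoc (Fin.init a) c : Fin (k + 1) → ℝ)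

/-- The weight `-log₂ p̂_{k+1}(a_{k+1} | a^k)` computed from `u^n`, with value `+∞` when
the pattern `a^{k+1}` does not occur in `u^n`. -/
def empWeight (k : ℕ) {n : ℕ} (u : Fin n → ℝ) (a : Fin (k + 1) → ℝ) : ℝ≥0∞ :=
  if empDist (k + 1) u a = 0 then ⊤ else ENNReal.ofReal (-Real.logb 2 (condEmpDist k u a))

/-- The vector `W* = (W*_{a^{k+1}} : a^{k+1} ∈ 𝒳_b^{k+1})` computed from `[x^n]_b`. -/
def idealWeight (𝒳 : Set ℝ) (b k : ℕ) {n : ℕ} (x : Fin n → ℝ) :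
    (Fin (k + 1) → quantAlphabet 𝒳 b) → ℝ≥0∞ :=
  fun a => empWeight k (quantVec b x) (fun t => (a t : ℝ))

/-- The `ℓ_∞` distance `sup_a |w_a - v_a|` of two weight vectors with entries in `[0, +∞]`;
`|∞ - ∞| = 0` and `|∞ - x| = ∞` for finite `x`. -/
def weightDist {ι : Type*} (w v : ι → ℝ≥0∞) : ℝ≥0∞ :=
  ⨆ a, max (w a - v a) (v a - w a)

/-- `c_w(u^n) = ∑_{a ∈ 𝒳_b^{k+1}} w_a p̂_{k+1}(a | u^n)`, with `∞ * 0 = 0`. -/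
def linCost (𝒳 : Set ℝ) (b k : ℕ) (w : (Fin (k + 1) → quantAlphabet 𝒳 b) → ℝ≥0∞)
    {n : ℕ} (u : Fin n → ℝ) : ℝ≥0∞ :=
  ∑' a : Fin (k + 1) → quantAlphabet 𝒳 b,
    w a * ENNReal.ofReal (empDist (k + 1) u (fun t => (a t : ℝ)))

/-- The Euclidean norm of a vector of reals. -/
def norm2 {n : ℕ} (x : Fin n → ℝ) : ℝ := ‖WithLp.toLp 2 x‖

/-- The A-MEP objective `c_w(u^n) + (λ / n²) ‖A u^n - y^m‖²`. -/
def amepCost (𝒳 : Set ℝ) (b k : ℕ) (w : (Fin (k + 1) → quantAlphabet 𝒳 b) → ℝ≥0∞)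
    (lam : ℝ) {m n : ℕ} (A : Matrix (Fin m) (Fin n) ℝ) (y : Fin m → ℝ) (u : Fin n → ℝ) : ℝ≥0∞ :=
  linCost 𝒳 b k w u + ENNReal.ofReal (lam / (n : ℝ) ^ 2 * norm2 (A.mulVec u - y) ^ 2)

/-- `v` is a minimizer of the A-MEP objective over `𝒳_b^n`. -/
def IsAMEPMinimizer (𝒳 : Set ℝ) (b k : ℕ) (w : (Fin (k + 1) → quantAlphabet 𝒳 b) → ℝ≥0∞)
    (lam : ℝ) {m n : ℕ} (A : Matrix (Fin m) (Fin n) ℝ) (y : Fin m → ℝ) (v : Fin n → ℝ) : Prop :=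
  (∀ i, v i ∈ quantAlphabet 𝒳 b) ∧
    ∀ u : Fin n → ℝ, (∀ i, u i ∈ quantAlphabet 𝒳 b) →
      amepCost 𝒳 b k w lam A y v ≤ amepCost 𝒳 b k w lam A y u

section Source

variable {Ω : Type*} [MeasurableSpace Ω]

/-- The initial segment `X^n`; the process is indexed from `0`. -/
def initial (X : ℕ → Ω → ℝ) (n : ℕ) (ω : Ω) : Fin n → ℝ := fun i => X i ω

/-- (Strict) stationarity: all time shifts of the process have the same law. -/
def IsStationary (X : ℕ → Ω → ℝ) (μ : Measure Ω) : Prop :=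
  ∀ s : ℕ, IdentDistrib (fun ω (i : ℕ) => X (i + s) ω) (fun ω (i : ℕ) => X i ω) μ μ

/-- The `σ`-field generated by the process up to time `j`. -/
@[reducible] def past (X : ℕ → Ω → ℝ) (j : ℕ) : MeasurableSpace Ω :=
  ⨆ i : {i : ℕ // i ≤ j}, MeasurableSpace.comap (X i) inferInstance

/-- The `σ`-field generated by the process from time `j` on. -/
@[reducible] def future (X : ℕ → Ω → ℝ) (j : ℕ) : MeasurableSpace Ω :=
  ⨆ i : {i : ℕ // j ≤ i}, MeasurableSpace.comap (X i) inferInstance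

/-- `ψ*(g) = sup P(A ∩ B) / (P(A) P(B))` over `j`, `A` in the past of `j` and `B` in the
future of `j + g` with `P(A) P(B) > 0`. -/
def psiStar (X : ℕ → Ω → ℝ) (μ : Measure Ω) (g : ℕ) : ℝ≥0∞ :=
  ⨆ (j : ℕ) (A : Set Ω) (B : Set Ω) (_ : MeasurableSet[past X j] A)
    (_ : MeasurableSet[future X (j + g)] B) (_ : 0 < μ A * μ B), μ (A ∩ B) / (μ A * μ B)

/-- `Ψ*`-mixing: `ψ*(g) → 1` as `g → ∞`. -/
def IsPsiStarMixing (X : ℕ → Ω → ℝ) (μ : Measure Ω) : Prop :=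
  Tendsto (psiStar X μ) atTop (𝓝 1)

/-- The conditional Shannon entropy in bits
`H(U | V) = ∑_{v,u} P(V = v, U = u) log₂ (P(V = v) / P(V = v, U = u))` of discrete random
variables. -/
def condEntropy {S T : Type*} (U : Ω → S) (V : Ω → T) (μ : Measure Ω) : ℝ≥0∞ :=
  ∑' p : T × S, ENNReal.ofReal (μ.real {ω | V ω = p.1 ∧ U ω = p.2} *
    Real.logb 2 (μ.real {ω | V ω = p.1} / μ.real {ω | V ω = p.1 ∧ U ω = p.2}))

/-- The `k`-th order upper information dimension
`d̄_k(X) = limsup_{b → ∞} H([X_{k+1}]_b | [X^k]_b) / b`. -/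
def upperIDk (X : ℕ → Ω → ℝ) (μ : Measure Ω) (k : ℕ) : ℝ≥0∞ :=
  limsup (fun b : ℕ => condEntropy (fun ω => quantize b (X k ω))
    (fun ω => quantVec b (initial X k ω)) μ / (b : ℝ≥0∞)) atTop

/-- `d` is the upper information dimension `d̄_o(X) = lim_{k → ∞} d̄_k(X)`. -/
def IsUpperID (X : ℕ → Ω → ℝ) (μ : Measure Ω) (d : ℝ≥0) : Prop :=
  Tendsto (upperIDk X μ) atTop (𝓝 (d : ℝ≥0∞))

/-- `A` is a random matrix whose entries are i.i.d. standard Gaussian. -/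
def IsStdGaussianMatrix {m n : ℕ} (A : Ω → Matrix (Fin m) (Fin n) ℝ) (μ : Measure Ω) : Prop :=
  (∀ i j, HasLaw (fun ω => A ω i j) (gaussianReal 0 1) μ) ∧
    iIndepFun (fun (p : Fin m × Fin n) ω => A ω p.1 p.2) μ

end Source

/-- The quantization level `b_n = ⌊r log₂ log₂ n⌋`. -/
def bitLevel (r : ℝ) (n : ℕ) : ℕ := ⌊r * Real.logb 2 (Real.logb 2 n)⌋₊

/-- The regularization coefficient `λ_n = (log₂ n)^{2r}`. -/
def lagrange (r : ℝ) (n : ℕ) : ℝ := (Real.logb 2 n) ^ (2 * r)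

end

end AMEP

namespace AMEP

noncomputable section

/-! The minimizer is compared with the quantized source `[X^n]_b`, which is itself admissible. With
high probability its ideal cost is at most `b (d + 3ε)`. By Gibbs' inequality
(`linCost_empWeight_self_le`) the empirical kernel of order `k` codes the sequence at least as well
as the true conditional law of any fixed order `l ≤ k`, up to smoothing. The average code length
under that law obeys a weak law of large numbers (`measure_average_quantWindow_ge_le`), because
`Ψ*`-mixing bounds covariances from above. The penalty of `[X^n]_b` has mean at most `4m/n`, since
`λ` is `4^b` up to a factor 4, and so is `o(b) m/n` in probability. As the weights are within `εb`
of the ideal ones, minimality (`IsAMEPMinimizer.cost_bounds`) bounds both the ideal cost and the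
penalty of the minimizer by some `R = b (d + 5ε) + o(b) m/n`.

Sequences of ideal cost at most `R` are few: Kraft's inequality leaves at most `|𝒳_b|^(k+1) 2^(nR)`
of them (`card_linCost_le`), and the first factor is `2^(o(bm))` since `k = o(n)`. If such a `u` is
at distance at least `τ√n` from the source, the coordinates of `A(u - X)` are i.i.d. Gaussian of
variance at least `nτ²`, so a Chernoff bound (`gaussian_mulVec_small_ball`) makes a penalty below
`R` as unlikely as `2^(-bm(1-o(1)))`. The union bound `measure_exists_far_candidate_le` closes
because `n (d + 5ε)` is below `m` by a fixed proportion.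

The union runs over candidates for the ideal weights, a set determined by the source alone and hence
independent of `A`. The actual weights and the minimizer, which may depend on `A`, enter only
through the deterministic cost bounds. -/

theorem norm2_sq {n : ℕ} (x : Fin n → ℝ) : norm2 x ^ 2 = ∑ i, x i ^ 2 := by
  unfold norm2
  rw [EuclideanSpace.norm_sq_eq]
  simp

theorem norm2_nonneg {n : ℕ} (x : Fin n → ℝ) : 0 ≤ norm2 x := norm_nonneg _

/-! ### Gaussian matrices acting on a fixed vector -/

/-- The law of a matrix with i.i.d. standard Gaussian entries. -/
def gaussianMatrixLaw (m n : ℕ) : Measure (Fin m × Fin n → ℝ) :=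
  Measure.pi fun _ => gaussianReal 0 1

instance (m n : ℕ) : IsProbabilityMeasure (gaussianMatrixLaw m n) := by
  unfold gaussianMatrixLaw; infer_instance

theorem IsStdGaussianMatrix.hasLaw {Ω : Type*} [MeasurableSpace Ω] {μ : Measure Ω} {m n : ℕ}
    {A : Ω → Matrix (Fin m) (Fin n) ℝ} (hA : IsStdGaussianMatrix A μ) :
    HasLaw (fun ω (p : Fin m × Fin n) => A ω p.1 p.2) (gaussianMatrixLaw m n) μ :=
  hA.2.hasLaw_pi fun p => hA.1 p.1 p.2

theorem gaussian_linear_combination {ι : Type*} [Fintype ι] (v : ι → ℝ) :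
    (Measure.pi fun _ : ι => gaussianReal 0 1).map (fun x => ∑ j, x j * v j) =
      gaussianReal 0 (∑ j, v j ^ 2).toNNReal := by
  refine Measure.ext_of_charFun ?_
  have hind : iIndepFun (fun (j : ι) (x : ι → ℝ) => x j * v j)
      (Measure.pi fun _ : ι => gaussianReal 0 1) :=
    iIndepFun_pi (X := fun j (x : ℝ) => x * v j) fun j => by fun_prop
  rw [hind.charFun_map_fun_sum_eq_prod
    (fun j => Measurable.aemeasurable (by fun_prop))]
  ext t
  have hj : ∀ j, (Measure.pi fun _ : ι => gaussianReal 0 1).map (fun x => x j * v j) =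
      gaussianReal 0 (v j ^ 2).toNNReal := by
    intro j
    have h1 : (Measure.pi fun _ : ι => gaussianReal 0 1).map (fun x => x j) = gaussianReal 0 1 :=
      (measurePreserving_eval (fun _ : ι => gaussianReal 0 1) j).map_eq
    have h2 := gaussianReal_map_mul_const (μ := 0) (v := 1) (v j)
    rw [← h1, Measure.map_map (by fun_prop) (by fun_prop)] at h2
    convert! h2 using 2
    · simp
    · ext; simp [sq_nonneg]
  simp only [Finset.prod_apply, hj, charFun_gaussianReal]
  rw [← Complex.exp_sum]
  congr 1
  rw [Real.coe_toNNReal _ (Finset.sum_nonneg fun _ _ => sq_nonneg _)]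
  simp [Finset.sum_mul, Finset.sum_div, Finset.sum_neg_distrib, sq_nonneg]

/-- Rescaling to unit variance leaves one Gaussian integral and also covers the degenerate case `V =
0`, where there is no density. -/
theorem lintegral_exp_neg_sq_gaussian (s : ℝ) (hs : 0 ≤ s) (V : ℝ≥0) :
    ∫⁻ x, ENNReal.ofReal (Real.exp (-s * x ^ 2)) ∂(gaussianReal 0 V) =
      ENNReal.ofReal (√(1 + 2 * s * V))⁻¹ := by
  have hV : gaussianReal 0 V = (gaussianReal 0 1).map (fun x => √(V : ℝ) * x) := by
    rw [gaussianReal_map_const_mul]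
    congr 1
    · simp
    · ext; simp
  rw [hV, lintegral_map (by fun_prop) (by fun_prop),
    ← ofReal_integral_eq_lintegral_ofReal]
  · rw [integral_gaussianReal_eq_integral_smul one_ne_zero]
    simp only [gaussianPDFReal, smul_eq_mul, sub_zero, NNReal.coe_one, mul_one]
    have h0 : 0 < 1 / 2 + s * V := by positivity
    have : ∀ x : ℝ, (√(2 * Real.pi))⁻¹ * Real.exp (-x ^ 2 / 2) *
        Real.exp (-s * (√(V : ℝ) * x) ^ 2)
        = (√(2 * Real.pi))⁻¹ * Real.exp (-(1 / 2 + s * V) * x ^ 2) := by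
      intro x
      rw [mul_pow, Real.sq_sqrt (NNReal.coe_nonneg V), mul_assoc, ← Real.exp_add]
      congr 2
      ring
    simp_rw [this]
    rw [integral_const_mul, integral_gaussian, ← Real.sqrt_inv, ← Real.sqrt_mul (by positivity),
      ← Real.sqrt_inv]
    congr 2
    field_simp
  · refine Integrable.mono' (integrable_const (1 : ℝ)) (by fun_prop) (ae_of_all _ fun x => ?_)
    rw [Real.norm_eq_abs, abs_of_pos (Real.exp_pos _)]
    exact Real.exp_le_one_iff.2 (by nlinarith [mul_nonneg hs (sq_nonneg (√(V : ℝ) * x))])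
  · exact ae_of_all _ fun x => (Real.exp_pos _).le

theorem lintegral_sq_gaussian (V : ℝ≥0) :
    ∫⁻ x, ENNReal.ofReal (x ^ 2) ∂(gaussianReal 0 V) = V := by
  have h := variance_fun_id_gaussianReal (μ := 0) (v := V)
  rw [variance_eq_integral (by fun_prop), integral_id_gaussianReal] at h
  simp only [sub_zero] at h
  rw [← ofReal_integral_eq_lintegral_ofReal, h, ENNReal.ofReal_coe_nnreal]
  · exact (memLp_id_gaussianReal 2).integrable_sq
  · exact ae_of_all _ fun x => sq_nonneg _

theorem measurable_gaussianMatrix_mulVec (m n : ℕ) (v : Fin n → ℝ) :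
    Measurable fun B : Fin m × Fin n → ℝ => (Matrix.of fun i j => B (i, j)).mulVec v := by
  refine measurable_pi_lambda _ fun i => ?_
  simp only [Matrix.mulVec, dotProduct, Matrix.of_apply]
  fun_prop

/-- A Gaussian matrix applied to a fixed vector has i.i.d. centred Gaussian coordinates. -/
theorem map_gaussianMatrixLaw_mulVec (m n : ℕ) (v : Fin n → ℝ) :
    (gaussianMatrixLaw m n).map (fun B => (Matrix.of fun i j => B (i, j)).mulVec v) =
      Measure.pi fun _ : Fin m =>
        gaussianReal 0 (∑ j, v j ^ 2).toNNReal := by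
  set P : Measure (Fin m → Fin n → ℝ) :=
    Measure.pi fun _ => Measure.pi fun _ => gaussianReal 0 1 with hP
  have hrow : ∀ i, P.map (fun x => x i) = Measure.pi fun _ => gaussianReal 0 1 := fun i =>
    (measurePreserving_eval (fun _ : Fin m => Measure.pi fun _ : Fin n => gaussianReal 0 1) i).map_eq
  have h1 : iIndepFun (fun i (x : Fin m → Fin n → ℝ) => fun j => x i j) P :=
    iIndepFun_pi (X := fun i (y : Fin n → ℝ) => y) fun i => by fun_prop
  have h2 : ∀ i, iIndepFun (fun j (x : Fin m → Fin n → ℝ) => x i j) P := by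
    intro i
    rw [iIndepFun_iff_map_fun_eq_pi_map (fun j => Measurable.aemeasurable (by fun_prop))]
    have : ∀ j, P.map (fun x => x i j) = gaussianReal 0 1 := by
      intro j
      rw [← (measurePreserving_eval (fun _ : Fin n => gaussianReal 0 1) j).map_eq, ← hrow i,
        Measure.map_map (by fun_prop) (by fun_prop)]
      rfl
    simp_rw [this]
    exact hrow i
  have h3 : iIndepFun (fun (p : Fin m × Fin n) (x : Fin m → Fin n → ℝ) => x p.1 p.2) P :=
    iIndepFun_uncurry' (X := fun i j (x : Fin m → Fin n → ℝ) => x i j)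
      (fun i j => by fun_prop) h1 h2
  -- Independence across rows is immediate for the iterated product `P`; this identifies `P`,
  -- uncurried, with the law indexed by pairs.
  have h4 : P.map (fun x (p : Fin m × Fin n) => x p.1 p.2) = gaussianMatrixLaw m n := by
    rw [h3.map_fun_eq_pi_map (fun p => Measurable.aemeasurable (by fun_prop))]
    unfold gaussianMatrixLaw
    congr 1
    ext1 p
    rw [← (measurePreserving_eval (fun _ : Fin n => gaussianReal 0 1) p.2).map_eq, ← hrow p.1,
      Measure.map_map (by fun_prop) (by fun_prop)]
    rfl
  rw [← h4, Measure.map_map]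
  · have h5 : iIndepFun (fun (i : Fin m) (x : Fin m → Fin n → ℝ) => ∑ j, x i j * v j) P :=
      iIndepFun_pi (X := fun i (y : Fin n → ℝ) => ∑ j, y j * v j) fun i => Measurable.aemeasurable (by fun_prop)
    have h6 := h5.map_fun_eq_pi_map (fun p => Measurable.aemeasurable (by fun_prop))
    refine h6.trans ?_
    congr 1
    ext1 i
    rw [← gaussian_linear_combination v, ← hrow i, Measure.map_map (by fun_prop) (by fun_prop)]
    rfl
  · exact measurable_gaussianMatrix_mulVec m n v
  · fun_prop

theorem measurable_matrix_mulVec (m n : ℕ) :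
    Measurable fun p : (Fin n → ℝ) × (Fin m × Fin n → ℝ) =>
      norm2 ((Matrix.of fun i j => p.2 (i, j)).mulVec p.1) ^ 2 := by
  simp only [norm2_sq, Matrix.mulVec, dotProduct, Matrix.of_apply]
  fun_prop

theorem lintegral_gaussian_mulVec (m n : ℕ) (v : Fin n → ℝ) :
    ∫⁻ B, ENNReal.ofReal (norm2 ((Matrix.of fun i j => B (i, j)).mulVec v) ^ 2)
      ∂(gaussianMatrixLaw m n) = m * ENNReal.ofReal (norm2 v ^ 2) := by
  have h := lintegral_map (μ := gaussianMatrixLaw m n)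
    (f := fun y : Fin m → ℝ => ENNReal.ofReal (norm2 y ^ 2))
    (g := fun B => (Matrix.of fun i j => B (i, j)).mulVec v)
    (by simp only [norm2_sq]; fun_prop)
    (measurable_gaussianMatrix_mulVec m n v)
  rw [← h, map_gaussianMatrixLaw_mulVec]
  simp_rw [norm2_sq, ENNReal.ofReal_sum_of_nonneg (fun _ _ => sq_nonneg _)]
  rw [lintegral_finsetSum _ (fun i _ => by fun_prop)]
  have : ∀ i : Fin m, ∫⁻ y : Fin m → ℝ, ENNReal.ofReal (y i ^ 2) ∂(Measure.pi fun _ : Fin m =>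
        gaussianReal 0 (∑ j, v j ^ 2).toNNReal)
        = ENNReal.ofReal (∑ j, v j ^ 2) := by
    intro i
    refine ((measurePreserving_eval (fun _ : Fin m => gaussianReal 0 (∑ j, v j ^ 2).toNNReal)
      i).lintegral_comp (f := fun x : ℝ => ENNReal.ofReal (x ^ 2)) (by fun_prop)).trans ?_
    rw [lintegral_sq_gaussian]
    rfl
  simp [this, ENNReal.ofReal_sum_of_nonneg (fun _ _ => sq_nonneg _)]

/-- Chernoff lower-tail bound for the norm of a Gaussian matrix applied to a vector. -/
theorem gaussian_mulVec_small_ball (m n : ℕ) (v : Fin n → ℝ) (s D T : ℝ) (hs : 0 ≤ s)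
    (hD0 : 0 ≤ D) (hD : D ≤ norm2 v ^ 2) :
    gaussianMatrixLaw m n {B | norm2 ((Matrix.of fun i j => B (i, j)).mulVec v) ^ 2 ≤ T} ≤
      ENNReal.ofReal (Real.exp (s * T) * ((√(1 + 2 * s * D))⁻¹) ^ m) := by
  set V : ℝ≥0 := (∑ j, v j ^ 2).toNNReal with hV
  have hset : MeasurableSet {y : Fin m → ℝ | norm2 y ^ 2 ≤ T} := by
    simp_rw [norm2_sq]
    exact measurableSet_le (by fun_prop) measurable_const
  have h := Measure.map_apply (μ := gaussianMatrixLaw m n) (measurable_gaussianMatrix_mulVec m n v) hset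
  rw [map_gaussianMatrixLaw_mulVec] at h
  change _ = gaussianMatrixLaw m n {B | norm2 ((Matrix.of fun i j => B (i, j)).mulVec v) ^ 2 ≤ T} at h
  rw [← h]
  set Q := Measure.pi fun _ : Fin m => gaussianReal 0 V with hQ
  have hint : ∫⁻ y, ∏ i, ENNReal.ofReal (Real.exp (-s * y i ^ 2)) ∂Q =
      ENNReal.ofReal (((√(1 + 2 * s * V))⁻¹) ^ m) := by
    rw [lintegral_prod_eq_prod_lintegral_of_indepFun Finset.univ
      (fun i (y : Fin m → ℝ) => ENNReal.ofReal (Real.exp (-s * y i ^ 2)))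
      (iIndepFun_pi (X := fun _ (x : ℝ) => ENNReal.ofReal (Real.exp (-s * x ^ 2)))
        fun i => by fun_prop) (fun i => by fun_prop)]
    have hi : ∀ i : Fin m, ∫⁻ y : Fin m → ℝ, ENNReal.ofReal (Real.exp (-s * y i ^ 2)) ∂Q =
        ENNReal.ofReal (√(1 + 2 * s * V))⁻¹ := fun i =>
      ((measurePreserving_eval (fun _ : Fin m => gaussianReal 0 V) i).lintegral_comp
        (f := fun x : ℝ => ENNReal.ofReal (Real.exp (-s * x ^ 2))) (by fun_prop)).trans
        (lintegral_exp_neg_sq_gaussian s hs V)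
    rw [Finset.prod_congr rfl fun i _ => hi i, Finset.prod_const, Finset.card_univ,
      Fintype.card_fin, ENNReal.ofReal_pow (by positivity)]
  -- Chernoff: the indicator of `‖y‖² ≤ T` is at most `exp (s (T - ‖y‖²))`, which factorizes over
  -- the coordinates.
  calc Q {y | norm2 y ^ 2 ≤ T}
      ≤ ∫⁻ y, ENNReal.ofReal (Real.exp (s * T)) *
          ∏ i, ENNReal.ofReal (Real.exp (-s * y i ^ 2)) ∂Q := by
        rw [← lintegral_indicator_one hset]
        refine lintegral_mono fun y => ?_
        by_cases hy : norm2 y ^ 2 ≤ T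
        · rw [Set.indicator_of_mem (by exact hy), ← ENNReal.ofReal_prod_of_nonneg
            (fun _ _ => (Real.exp_pos _).le), ← ENNReal.ofReal_mul (Real.exp_pos _).le,
            ← Real.exp_sum, ← Real.exp_add, Pi.one_apply, ENNReal.one_le_ofReal,
            Real.one_le_exp_iff, ← Finset.mul_sum, ← norm2_sq]
          nlinarith
        · rw [Set.indicator_of_notMem (by exact hy)]
          exact zero_le
    _ = ENNReal.ofReal (Real.exp (s * T) * ((√(1 + 2 * s * V))⁻¹) ^ m) := by
        rw [lintegral_const_mul _ (by fun_prop), hint, ENNReal.ofReal_mul (Real.exp_pos _).le]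
    _ ≤ _ := by
        refine ENNReal.ofReal_le_ofReal ?_
        have : D ≤ V := by rw [norm2_sq] at hD; exact hD.trans (Real.le_coe_toNNReal _)
        gcongr

/-! ### Empirical distributions and the linear cost -/

/-- The window of length `k` of `u` starting at position `j`. -/
def window {α : Type*} {n : ℕ} (k : ℕ) (u : Fin n → α) (j : Fin (n - k)) : Fin k → α :=
  fun t => u ⟨j + t, by omega⟩

theorem window_comp {α β : Type*} {n : ℕ} (f : α → β) (k : ℕ) (u : Fin n → α) (j : Fin (n - k)) :
    window k (fun i => f (u i)) j = fun t => f (window k u j t) := rfl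

open Classical in
theorem empDist_eq_sum (k : ℕ) {n : ℕ} (u : Fin n → ℝ) (a : Fin k → ℝ) :
    empDist k u a = (∑ j, if window k u j = a then (1 : ℝ) else 0) / ((n - k : ℕ) : ℝ) := by
  unfold empDist
  congr 1
  rw [Nat.card_eq_fintype_card, Fintype.card_subtype, Finset.sum_boole]
  congr 2
  ext j
  simp [window, funext_iff]

theorem empDist_nonneg (k : ℕ) {n : ℕ} (u : Fin n → ℝ) (a : Fin k → ℝ) : 0 ≤ empDist k u a := by
  unfold empDist; positivity

theorem ite_one_congr {p q : Prop} {_ : Decidable p} {_ : Decidable q} (h : p ↔ q) :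
    (if p then (1 : ℝ) else 0) = if q then 1 else 0 := if_congr h rfl rfl

/-- The number of windows of length `k + 1` whose first `k` symbols are `c`. -/
def contextCount {α : Type*} (k : ℕ) {n : ℕ} (u : Fin n → α) (c : Fin k → α) : ℝ :=
  open Classical in ∑ j, if Fin.init (window (k + 1) u j) = c then (1 : ℝ) else 0

theorem contextCount_nonneg {α : Type*} (k : ℕ) {n : ℕ} (u : Fin n → α) (c : Fin k → α) :
    0 ≤ contextCount k u c :=
  Finset.sum_nonneg fun _ _ => by split_ifs <;> norm_num

-- Each window with context `c` has exactly one last symbol, so the normalizing sum over all reals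
-- in `condEmpDist` is a context count.
open Classical in
theorem hasSum_empDist_snoc (k : ℕ) {n : ℕ} (u : Fin n → ℝ) (c : Fin k → ℝ) :
    HasSum (fun x : ℝ => empDist (k + 1) u (Fin.snoc c x : Fin (k + 1) → ℝ))
      (contextCount k u c / ((n - (k + 1) : ℕ) : ℝ)) := by
  simp only [empDist_eq_sum, contextCount]
  refine HasSum.div_const (hasSum_sum fun j _ => ?_) _
  have key : ∀ x : ℝ, (window (k + 1) u j = (Fin.snoc c x : Fin (k + 1) → ℝ)) ↔
      (Fin.init (window (k + 1) u j) = c ∧ x = window (k + 1) u j (Fin.last k)) := by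
    intro x
    constructor
    · intro e; rw [e]; simp
    · rintro ⟨rfl, rfl⟩; exact (Fin.snoc_init_self _).symm
  simp only [key]
  by_cases h : Fin.init (window (k + 1) u j) = c
  · simp only [h, true_and, if_true]
    exact hasSum_ite_eq (window (k + 1) u j (Fin.last k)) (1 : ℝ)
  · simp only [h, false_and, if_false]
    exact hasSum_zero

theorem condEmpDist_nonneg (k : ℕ) {n : ℕ} (u : Fin n → ℝ) (a : Fin (k + 1) → ℝ) :
    0 ≤ condEmpDist k u a :=
  div_nonneg (empDist_nonneg _ _ _) (tsum_nonneg fun _ => empDist_nonneg _ _ _)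

/-- The empirical conditional probabilities given a fixed context sum to at most one. -/
theorem sum_condEmpDist_le_one (k : ℕ) {n : ℕ} (u : Fin n → ℝ) (c : Fin k → ℝ) (s : Finset ℝ) :
    ∑ x ∈ s, condEmpDist k u (Fin.snoc c x : Fin (k + 1) → ℝ) ≤ 1 := by
  unfold condEmpDist
  simp only [Fin.init_snoc]
  rw [← Finset.sum_div]
  refine div_le_one_of_le₀ ?_ (tsum_nonneg fun _ => empDist_nonneg _ _ _)
  exact (hasSum_empDist_snoc k u c).summable.sum_le_tsum s fun _ _ => empDist_nonneg _ _ _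

theorem condEmpDist_le_one (k : ℕ) {n : ℕ} (u : Fin n → ℝ) (a : Fin (k + 1) → ℝ) :
    condEmpDist k u a ≤ 1 := by
  have := sum_condEmpDist_le_one k u (Fin.init a) {a (Fin.last k)}
  rwa [Finset.sum_singleton, Fin.snoc_init_self] at this

theorem condEmpDist_pos (k : ℕ) {n : ℕ} (u : Fin n → ℝ) (a : Fin (k + 1) → ℝ)
    (h : empDist (k + 1) u a ≠ 0) : 0 < condEmpDist k u a := by
  have h0 := (empDist_nonneg (k + 1) u a).lt_of_ne' h
  refine div_pos h0 (h0.trans_le ?_)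
  have := (hasSum_empDist_snoc k u (Fin.init a)).summable.le_tsum (a (Fin.last k))
    fun _ _ => empDist_nonneg _ _ _
  rwa [Fin.snoc_init_self] at this

theorem empDist_window_ne_zero (k : ℕ) {n : ℕ} (u : Fin n → ℝ) (j : Fin (n - k)) :
    empDist k u (window k u j) ≠ 0 := by
  have hM : 0 < n - k := j.pos
  rw [empDist_eq_sum]
  refine (div_pos (Finset.sum_pos' (fun _ _ => by split_ifs <;> norm_num)
    ⟨j, Finset.mem_univ _, by simp⟩) (by exact_mod_cast hM)).ne'

/-- The linear cost of a sequence is the average of the weights of its windows. -/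
theorem linCost_eq_average (𝒳 : Set ℝ) (b k : ℕ)
    (w : (Fin (k + 1) → quantAlphabet 𝒳 b) → ℝ≥0∞) {n : ℕ} (u : Fin n → quantAlphabet 𝒳 b) :
    linCost 𝒳 b k w (fun i => (u i : ℝ)) =
      (∑ j, w (window (k + 1) u j)) / ((n - (k + 1) : ℕ) : ℝ≥0∞) := by
  classical
  unfold linCost
  rcases Nat.eq_zero_or_pos (n - (k + 1)) with hM | hM
  · have h0 : ∀ a : Fin (k + 1) → quantAlphabet 𝒳 b,
        empDist (k + 1) (fun i => (u i : ℝ)) (fun t => (a t : ℝ)) = 0 := by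
      intro a; rw [empDist_eq_sum, show ((n - (k + 1) : ℕ) : ℝ) = 0 by rw [hM, Nat.cast_zero], div_zero]
    have : IsEmpty (Fin (n - (k + 1))) := by rw [hM]; infer_instance
    simp [h0]
  · have h1 : ∀ a : Fin (k + 1) → quantAlphabet 𝒳 b,
        w a * ENNReal.ofReal (empDist (k + 1) (fun i => (u i : ℝ)) (fun t => (a t : ℝ))) =
        (∑ j, if a = window (k + 1) u j then w a else 0) / ((n - (k + 1) : ℕ) : ℝ≥0∞) := by
      intro a
      rw [empDist_eq_sum, ENNReal.ofReal_div_of_pos (by exact_mod_cast hM), ENNReal.ofReal_natCast,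
        ENNReal.ofReal_sum_of_nonneg (fun _ _ => by split_ifs <;> norm_num), ← mul_div_assoc,
        Finset.mul_sum]
      congr 1
      refine Finset.sum_congr rfl fun j _ => ?_
      have : (window (k + 1) (fun i => (u i : ℝ)) j = fun t => (a t : ℝ)) ↔
          a = window (k + 1) u j := by
        rw [window_comp]
        simp only [funext_iff, Subtype.ext_iff]
        exact forall_congr' fun t => eq_comm
      simp only [this]
      split_ifs <;> simp
    simp only [h1, div_eq_mul_inv]
    rw [ENNReal.tsum_mul_right, Summable.tsum_finsetSum fun _ _ => ENNReal.summable]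
    congr 1
    refine Finset.sum_congr rfl fun j _ => ?_
    rw [tsum_eq_single (window (k + 1) u j) (fun a ha => if_neg ha), if_pos rfl]

/-! ### Kraft's inequality and the number of cheap sequences -/

/-- A conditional sub-probability kernel of order `k` on a finite alphabet. -/
def IsSubKernel {α : Type*} [Fintype α] {k : ℕ} (q : (Fin (k + 1) → α) → ℝ) : Prop :=
  (∀ a, 0 ≤ q a) ∧ ∀ c : Fin k → α, ∑ x, q (Fin.snoc c x : Fin (k + 1) → α) ≤ 1

theorem IsSubKernel.le_one {α : Type*} [Fintype α] {k : ℕ} {q : (Fin (k + 1) → α) → ℝ}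
    (hq : IsSubKernel q) (a : Fin (k + 1) → α) : q a ≤ 1 := by
  refine le_trans ?_ (hq.2 (Fin.init a))
  conv_lhs => rw [← Fin.snoc_init_self a]
  exact Finset.single_le_sum (f := fun x => q (Fin.snoc (Fin.init a) x : Fin (k + 1) → α))
    (fun _ _ => hq.1 _) (Finset.mem_univ _)

theorem sum_snoc {α : Type*} [Fintype α] {k : ℕ} (f : (Fin (k + 1) → α) → ℝ) :
    ∑ a, f a = ∑ c : Fin k → α, ∑ x, f (Fin.snoc c x : Fin (k + 1) → α) := by
  rw [← (Fin.snocEquiv fun _ : Fin (k + 1) => α).sum_comp f, Fintype.sum_prod_type_right]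
  rfl

theorem isSubKernel_condEmpDist (S : Set ℝ) [Fintype S] (k : ℕ) {n : ℕ} (u : Fin n → ℝ) :
    IsSubKernel fun a : Fin (k + 1) → S => condEmpDist k u (fun t => (a t : ℝ)) := by
  refine ⟨fun a => condEmpDist_nonneg _ _ _, fun c => ?_⟩
  classical
  have h := sum_condEmpDist_le_one k u (fun t => (c t : ℝ)) 
    ((Finset.univ : Finset S).image Subtype.val)
  rw [Finset.sum_image Subtype.val_injective.injOn] at h
  refine le_trans (le_of_eq (Finset.sum_congr rfl fun x _ => ?_)) h
  have : (fun t => ((Fin.snoc c x : Fin (k + 1) → S) t : ℝ)) =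
      (Fin.snoc (fun t => (c t : ℝ)) (x : ℝ) : Fin (k + 1) → ℝ) := by
    ext t
    refine Fin.lastCases ?_ (fun i => ?_) t
    · rw [Fin.snoc_last, Fin.snoc_last]
    · rw [Fin.snoc_castSucc, Fin.snoc_castSucc]
  simp only [this]

/-- Only the last factor involves the last symbol, and it sums to at most one over that symbol.
Peeling off symbols leaves the `k` initial ones, which are unconstrained. -/
theorem kraft_aux {α : Type*} [Fintype α] {k : ℕ} {q : (Fin (k + 1) → α) → ℝ}
    (hq : IsSubKernel q) (M : ℕ) :
    ∑ u : Fin (k + M) → α, ∏ j : Fin M, q (fun t => u ⟨j + t, by omega⟩) ≤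
      (Fintype.card α : ℝ) ^ k := by
  induction M with
  | zero => simp
  | succ M ih =>
    refine le_trans ?_ ih
    · change ∑ u : Fin ((k + M) + 1) → α, _ ≤ _
      rw [sum_snoc]
      refine Finset.sum_le_sum fun u _ => ?_
      simp only [Fin.prod_univ_castSucc]
      have h1 : ∀ (x : α) (j : Fin M),
          (fun t : Fin (k + 1) => (Fin.snoc u x : Fin (k + M + 1) → α)
            ⟨(j.castSucc : Fin (M + 1)) + t, by simp; omega⟩) =
            fun t : Fin (k + 1) => u ⟨j + t, by omega⟩ := by
        intro x j
        ext t
        have : (⟨(j.castSucc : Fin (M + 1)) + t, by simp; omega⟩ : Fin (k + M + 1)) =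
          Fin.castSucc ⟨j + t, by omega⟩ := rfl
        rw [this, Fin.snoc_castSucc]
      have h2 : ∀ x : α,
          (fun t : Fin (k + 1) => (Fin.snoc u x : Fin (k + M + 1) → α)
            ⟨(Fin.last M : Fin (M + 1)) + t, by simp; omega⟩) =
          (Fin.snoc (fun t : Fin k => u ⟨M + t, by omega⟩) x : Fin (k + 1) → α) := by
        intro x
        ext t
        refine Fin.lastCases ?_ (fun i => ?_) t
        · rw [Fin.snoc_last]
          have : (⟨(Fin.last M : Fin (M + 1)) + (Fin.last k : Fin (k + 1)), by simp; omega⟩ :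
            Fin (k + M + 1)) = Fin.last _ := by ext; simp [add_comm]
          rw [this, Fin.snoc_last]
        · rw [Fin.snoc_castSucc]
          have : (⟨(Fin.last M : Fin (M + 1)) + (i.castSucc : Fin (k + 1)), by simp; omega⟩ :
            Fin (k + M + 1)) = Fin.castSucc ⟨M + i, by omega⟩ := rfl
          rw [this, Fin.snoc_castSucc]
      simp only [h1, h2]
      rw [← Finset.mul_sum]
      exact mul_le_of_le_one_right (Finset.prod_nonneg fun _ _ => hq.1 _) (hq.2 _)

/-- With the normalization `n - (k + 1)`, no window of length `k + 1` reaches the last symbol of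
`u`. That symbol is free and costs one more factor of the alphabet size than in `kraft_aux`. -/
theorem kraft {α : Type*} [Fintype α] {k n : ℕ} {q : (Fin (k + 1) → α) → ℝ}
    (hq : IsSubKernel q) (hn : k + 1 ≤ n) :
    ∑ u : Fin n → α, ∏ j, q (window (k + 1) u j) ≤ (Fintype.card α : ℝ) ^ (k + 1) := by
  obtain ⟨M, rfl⟩ : ∃ M, n = (k + M) + 1 := ⟨n - (k + 1), by omega⟩
  have hM : k + M + 1 - (k + 1) = M := by omega
  have h1 : ∀ u : Fin (k + M + 1) → α, ∏ j, q (window (k + 1) u j) =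
      ∏ j : Fin M, q (fun t => u ⟨j + t, by omega⟩) := by
    intro u
    rw [← (finCongr hM).symm.prod_comp]
    rfl
  simp only [h1]
  rw [sum_snoc]
  have h2 : ∀ (u : Fin (k + M) → α) (x : α),
      ∏ j : Fin M, q (fun t => (Fin.snoc u x : Fin (k + M + 1) → α) ⟨j + t, by omega⟩) =
      ∏ j : Fin M, q (fun t => u ⟨j + t, by omega⟩) := by
    intro u x
    refine Finset.prod_congr rfl fun j _ => ?_
    congr 1
    ext t
    have : (⟨j + t, by omega⟩ : Fin (k + M + 1)) = Fin.castSucc ⟨j + t, by omega⟩ := rfl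
    rw [this, Fin.snoc_castSucc]
  simp only [h2, Finset.sum_const, Finset.card_univ, nsmul_eq_mul]
  rw [← Finset.mul_sum, pow_succ, mul_comm]
  gcongr
  exact kraft_aux hq M

/-- The number of sequences of small cost with respect to a fixed empirical weight vector. -/
theorem card_linCost_le (𝒳 : Set ℝ) (b k : ℕ) [Fintype (quantAlphabet 𝒳 b)] {n : ℕ}
    (v : Fin n → ℝ) (hn : k + 1 ≤ n) (R : ℝ) (hR : 0 ≤ R) :
    (Nat.card {u : Fin n → quantAlphabet 𝒳 b // linCost 𝒳 b k
      (fun a => empWeight k v (fun t => (a t : ℝ))) (fun i => (u i : ℝ)) ≤ ENNReal.ofReal R} : ℝ) ≤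
      (Fintype.card (quantAlphabet 𝒳 b) : ℝ) ^ (k + 1) * 2 ^ (n * R) := by
  classical
  set w : (Fin (k + 1) → quantAlphabet 𝒳 b) → ℝ≥0∞ :=
    fun a => empWeight k v (fun t => (a t : ℝ)) with hw
  set q : (Fin (k + 1) → quantAlphabet 𝒳 b) → ℝ :=
    fun a => condEmpDist k v (fun t => (a t : ℝ)) with hq
  have hqk : IsSubKernel q := isSubKernel_condEmpDist _ k v
  set U : Finset (Fin n → quantAlphabet 𝒳 b) := Finset.univ.filter fun u =>
    linCost 𝒳 b k w (fun i => (u i : ℝ)) ≤ ENNReal.ofReal R with hU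
  have hcard : (Nat.card {u : Fin n → quantAlphabet 𝒳 b //
      linCost 𝒳 b k w (fun i => (u i : ℝ)) ≤ ENNReal.ofReal R}) = U.card := by
    rw [Nat.card_eq_fintype_card, Fintype.card_subtype]
  rw [hcard]
  -- The cost is the average of `-log₂ q` over the windows, so a small cost is a lower bound on the
  -- product that Kraft's inequality sums.
  have key : ∀ u ∈ U, (2 : ℝ) ^ (-(n * R)) ≤ ∏ j, q (window (k + 1) u j) := by
    intro u hu
    rw [hU, Finset.mem_filter, linCost_eq_average] at hu
    have hu := hu.2
    rcases Nat.eq_zero_or_pos (n - (k + 1)) with hM | hM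
    · have : IsEmpty (Fin (n - (k + 1))) := by rw [hM]; infer_instance
      rw [Finset.univ_eq_empty, Finset.prod_empty]
      exact Real.rpow_le_one_of_one_le_of_nonpos (by norm_num)
        (neg_nonpos.2 (by positivity))
    rw [ENNReal.div_le_iff (by exact_mod_cast hM.ne') (by simp)] at hu
    -- A finite cost excludes windows of infinite weight, so `u` uses only patterns that occur in
    -- `v`, and there `q` is positive.
    have hne : ∀ j, w (window (k + 1) u j) ≠ ⊤ := by
      intro j hj
      have h1 : (⊤ : ℝ≥0∞) ≤ ∑ j, w (window (k + 1) u j) := by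
        rw [← hj]; exact Finset.single_le_sum
            (f := fun j => w (window (k + 1) u j)) (fun _ _ => zero_le) (Finset.mem_univ j)
      exact absurd (h1.trans hu) (not_le.2 (ENNReal.mul_lt_top ENNReal.ofReal_lt_top (ENNReal.natCast_lt_top _)))
    have hpos : ∀ j, 0 < q (window (k + 1) u j) ∧ w (window (k + 1) u j) =
        ENNReal.ofReal (-Real.logb 2 (q (window (k + 1) u j))) := by
      intro j
      have h1 := hne j
      simp only [hw, empWeight] at h1 ⊢
      split_ifs at h1 ⊢ with h2
      · exact absurd rfl h1
      · exact ⟨condEmpDist_pos _ _ _ h2, rfl⟩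
    simp only [fun j => (hpos j).2] at hu
    have hnn : ∀ j, 0 ≤ -Real.logb 2 (q (window (k + 1) u j)) := fun j =>
      neg_nonneg.2 (Real.logb_nonpos (by norm_num) (hqk.1 _) (hqk.le_one _))
    rw [← ENNReal.ofReal_sum_of_nonneg (fun j _ => hnn j), ← ENNReal.ofReal_natCast,
      ← ENNReal.ofReal_mul hR, ENNReal.ofReal_le_ofReal_iff (by positivity),
      Finset.sum_neg_distrib, ← Real.logb_prod _ _ (fun j _ => (hpos j).1.ne')] at hu
    rw [← Real.le_logb_iff_rpow_le (by norm_num) (Finset.prod_pos fun j _ => (hpos j).1)]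
    have h3 : R * ((n - (k + 1) : ℕ) : ℝ) ≤ n * R := by
      rw [mul_comm]; gcongr; exact Nat.sub_le _ _
    linarith
  have h4 : (U.card : ℝ) * 2 ^ (-(n * R)) ≤
      (Fintype.card (quantAlphabet 𝒳 b) : ℝ) ^ (k + 1) := by
    calc (U.card : ℝ) * 2 ^ (-(n * R)) = ∑ u ∈ U, (2 : ℝ) ^ (-(n * R)) := by simp
      _ ≤ ∑ u ∈ U, ∏ j, q (window (k + 1) u j) := Finset.sum_le_sum key
      _ ≤ ∑ u, ∏ j, q (window (k + 1) u j) :=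
        Finset.sum_le_sum_of_subset_of_nonneg (Finset.subset_univ _)
          fun _ _ _ => Finset.prod_nonneg fun _ _ => hqk.1 _
      _ ≤ _ := kraft hqk hn
  rw [Real.rpow_neg (by norm_num), ← div_eq_mul_inv, div_le_iff₀ (by positivity)] at h4
  exact h4

/-! ### Gibbs' inequality for empirical kernels -/

theorem condEmpDist_coe (S : Set ℝ) (k : ℕ) {n : ℕ} (v : Fin n → S) (hM : 0 < n - (k + 1))
    (a : Fin (k + 1) → S) :
    condEmpDist k (fun i => (v i : ℝ)) (fun t => (a t : ℝ)) =
      (open Classical in ∑ j, if window (k + 1) v j = a then (1 : ℝ) else 0) /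
        contextCount k v (Fin.init a) := by
  classical
  have e1 : empDist (k + 1) (fun i => (v i : ℝ)) (fun t => (a t : ℝ)) =
      (∑ j, if window (k + 1) v j = a then (1 : ℝ) else 0) / ((n - (k + 1) : ℕ) : ℝ) := by
    rw [empDist_eq_sum]
    congr 1
    refine Finset.sum_congr rfl fun j _ => ite_one_congr ?_
    rw [window_comp]
    simp only [funext_iff, Subtype.ext_iff]
  have e2 : contextCount k (fun i => (v i : ℝ)) (Fin.init fun t => (a t : ℝ)) =
      contextCount k v (Fin.init a) := by
    unfold contextCount
    refine Finset.sum_congr rfl fun j _ => ite_one_congr ?_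
    rw [window_comp]
    simp only [funext_iff, Subtype.ext_iff, Fin.init]
  have hM' : ((n - (k + 1) : ℕ) : ℝ) ≠ 0 := by exact_mod_cast hM.ne'
  unfold condEmpDist
  rw [(hasSum_empDist_snoc k _ _).tsum_eq, e1, e2, div_div_div_cancel_right₀ hM']

/-- Grouping the windows by pattern `a` cancels the count of `a` and leaves `q a` times the count of
its context. Summing over the last symbol uses the kernel property, and the context counts add up to
the number of windows. -/
theorem sum_div_condEmpDist_le (S : Set ℝ) [Fintype S] (k : ℕ) {n : ℕ} (v : Fin n → S)
    (hM : 0 < n - (k + 1)) (q : (Fin (k + 1) → S) → ℝ) (hq : IsSubKernel q) :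
    ∑ j, q (window (k + 1) v j) /
      condEmpDist k (fun i => (v i : ℝ)) (fun t => ((window (k + 1) v j t : S) : ℝ)) ≤
      ((n - (k + 1) : ℕ) : ℝ) := by
  classical
  set cnt : (Fin (k + 1) → S) → ℝ :=
    fun a => ∑ j, if window (k + 1) v j = a then (1 : ℝ) else 0 with hcnt
  have hcnt0 : ∀ a, 0 ≤ cnt a := fun a => Finset.sum_nonneg fun _ _ => by split_ifs <;> norm_num
  have hgc : ∀ a : Fin (k + 1) → S, condEmpDist k (fun i => (v i : ℝ)) (fun t => (a t : ℝ)) =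
      cnt a / contextCount k v (Fin.init a) := fun a => condEmpDist_coe S k v hM a
  simp only [hgc]
  calc ∑ j, q (window (k + 1) v j) /
        (cnt (window (k + 1) v j) / contextCount k v (Fin.init (window (k + 1) v j)))
      = ∑ j, ∑ a, (if window (k + 1) v j = a then
          q a / (cnt a / contextCount k v (Fin.init a)) else 0) := by
        refine Finset.sum_congr rfl fun j _ => ?_
        rw [Finset.sum_ite_eq, if_pos (Finset.mem_univ _)]
    _ = ∑ a, cnt a * (q a / (cnt a / contextCount k v (Fin.init a))) := by
        rw [Finset.sum_comm]
        refine Finset.sum_congr rfl fun a _ => ?_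
        rw [hcnt, Finset.sum_mul]
        exact Finset.sum_congr rfl fun j _ => by split_ifs <;> simp
    _ ≤ ∑ a, q a * contextCount k v (Fin.init a) := by
        refine Finset.sum_le_sum fun a _ => ?_
        rcases (hcnt0 a).eq_or_lt with h | h
        · rw [← h, zero_mul]
          exact mul_nonneg (hq.1 _) (contextCount_nonneg _ _ _)
        · refine le_of_eq ?_
          field_simp
    _ = ∑ c : Fin k → S, contextCount k v c *
          ∑ x, q (Fin.snoc c x : Fin (k + 1) → S) := by
        rw [sum_snoc]
        refine Finset.sum_congr rfl fun c _ => ?_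
        rw [Finset.mul_sum]
        refine Finset.sum_congr rfl fun x _ => ?_
        rw [Fin.init_snoc, mul_comm]
    _ ≤ ∑ c : Fin k → S, contextCount k v c :=
        Finset.sum_le_sum fun c _ =>
          mul_le_of_le_one_right (contextCount_nonneg _ _ _) (hq.2 c)
    _ = ((n - (k + 1) : ℕ) : ℝ) := by
        unfold contextCount
        rw [Finset.sum_comm]
        refine (Finset.sum_congr rfl fun j _ => ?_).trans
          (b := ∑ _j : Fin (n - (k + 1)), (1 : ℝ)) ?_
        · exact (Finset.sum_eq_single (Fin.init (window (k + 1) v j))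
            (fun c _ hc => if_neg (Ne.symm hc)) (fun h => absurd (Finset.mem_univ _) h)).trans
            (if_pos rfl)
        · rw [Finset.sum_const, Finset.card_univ, Fintype.card_fin, nsmul_eq_mul, mul_one]

/-- Gibbs' inequality: the empirical conditional distribution of a sequence gives it the shortest
code length among all conditional distributions of the same order. -/
theorem linCost_empWeight_self_le (𝒳 : Set ℝ) (b k : ℕ) [Fintype (quantAlphabet 𝒳 b)] {n : ℕ}
    (v : Fin n → quantAlphabet 𝒳 b) (q : (Fin (k + 1) → quantAlphabet 𝒳 b) → ℝ)
    (hq : IsSubKernel q) (hq0 : ∀ a, 0 < q a) :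
    linCost 𝒳 b k (fun a => empWeight k (fun i => (v i : ℝ)) (fun t => (a t : ℝ)))
      (fun i => (v i : ℝ)) ≤
      ENNReal.ofReal ((∑ j, -Real.logb 2 (q (window (k + 1) v j))) /
        ((n - (k + 1) : ℕ) : ℝ)) := by
  rw [linCost_eq_average]
  rcases Nat.eq_zero_or_pos (n - (k + 1)) with hM | hM
  · have : IsEmpty (Fin (n - (k + 1))) := by rw [hM]; infer_instance
    simp
  set g : (Fin (k + 1) → quantAlphabet 𝒳 b) → ℝ :=
    fun a => condEmpDist k (fun i => (v i : ℝ)) (fun t => (a t : ℝ)) with hg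
  have hg0 : ∀ a, 0 ≤ g a := fun a => condEmpDist_nonneg _ _ _
  have hg1 : ∀ a, g a ≤ 1 := fun a => condEmpDist_le_one _ _ _
  have hne : ∀ j, empDist (k + 1) (fun i => (v i : ℝ))
      (fun t => ((window (k + 1) v j t : quantAlphabet 𝒳 b) : ℝ)) ≠ 0 := fun j =>
    empDist_window_ne_zero (k + 1) (fun i => (v i : ℝ)) j
  have hpos : ∀ j, 0 < g (window (k + 1) v j) := fun j => condEmpDist_pos _ _ _ (hne j)
  have hw : ∀ j, empWeight k (fun i => (v i : ℝ)) (fun t => ((window (k + 1) v j t : quantAlphabet 𝒳 b) : ℝ)) =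
      ENNReal.ofReal (-Real.logb 2 (g (window (k + 1) v j))) := by
    intro j
    unfold empWeight
    rw [if_neg (hne j)]
  have hnn : ∀ j, 0 ≤ -Real.logb 2 (g (window (k + 1) v j)) := fun j =>
    neg_nonneg.2 (Real.logb_nonpos (by norm_num) (hg0 _) (hg1 _))
  rw [Finset.sum_congr rfl fun j _ => hw j,
    ← ENNReal.ofReal_sum_of_nonneg (fun j _ => hnn j), ← ENNReal.ofReal_natCast,
    ← ENNReal.ofReal_div_of_pos (Nat.cast_pos.2 hM)]
  refine ENNReal.ofReal_le_ofReal (div_le_div_of_nonneg_right ?_ (Nat.cast_nonneg _))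
  have hsum : ∑ j, q (window (k + 1) v j) / g (window (k + 1) v j) ≤ ((n - (k + 1) : ℕ) : ℝ) :=
    sum_div_condEmpDist_le _ k v hM q hq
  -- `log x ≤ x - 1` at the likelihood ratio; the sum of the right-hand sides is nonpositive by
  -- `hsum`.
  have hlog : ∀ j, Real.logb 2 (q (window (k + 1) v j)) - Real.logb 2 (g (window (k + 1) v j)) ≤
      (q (window (k + 1) v j) / g (window (k + 1) v j) - 1) / Real.log 2 := by
    intro j
    rw [← Real.logb_div (hq0 _).ne' (hpos j).ne', Real.logb]
    refine div_le_div_of_nonneg_right ?_ (Real.log_nonneg (by norm_num))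
    exact Real.log_le_sub_one_of_pos (div_pos (hq0 _) (hpos j))
  have h5 := Finset.sum_le_sum fun j (_ : j ∈ Finset.univ) => hlog j
  rw [← Finset.sum_div, Finset.sum_sub_distrib, Finset.sum_sub_distrib] at h5
  have h6 : (∑ j, q (window (k + 1) v j) / g (window (k + 1) v j) -
      ∑ _j : Fin (n - (k + 1)), (1 : ℝ)) / Real.log 2 ≤ 0 := by
    refine div_nonpos_of_nonpos_of_nonneg ?_ (Real.log_nonneg (by norm_num))
    rw [Finset.sum_const, Finset.card_univ, Fintype.card_fin, nsmul_eq_mul, mul_one]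
    linarith
  simp only [Finset.sum_neg_distrib]
  linarith

/-! ### Mixing and a weak law for windows of the quantized process -/

theorem measurable_quantize (b : ℕ) : Measurable (quantize b) := by
  have : quantize b = fun x => (⌊(2 : ℝ) ^ b * x⌋ : ℝ) / 2 ^ b := funext (quantize_eq b)
  rw [this]
  have h : Measurable fun x : ℝ => ⌊(2 : ℝ) ^ b * x⌋ :=
    Int.measurable_floor.comp (measurable_const_mul _)
  exact ((measurable_from_top (f := fun z : ℤ => (z : ℝ))).comp h).div_const _

/-- The event that the quantized process shows the pattern `a` from time `j` on. -/
def patternEvent {Ω : Type*} (X : ℕ → Ω → ℝ) (b j : ℕ) {l : ℕ} (a : Fin l → ℝ) : Set Ω :=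
  {ω | ∀ t : Fin l, quantize b (X (j + t) ω) = a t}

section QuantizedSource

variable {Ω : Type*} {X : ℕ → Ω → ℝ}

theorem measurableSet_patternEvent_of {m : MeasurableSpace Ω} (b j : ℕ) {l : ℕ} (a : Fin l → ℝ)
    (h : ∀ t : Fin l, Measurable[m] (X (j + t))) : MeasurableSet[m] (patternEvent X b j a) := by
  have : patternEvent X b j a = ⋂ t : Fin l, X (j + t) ⁻¹' (quantize b ⁻¹' {a t}) := by
    ext ω; simp [patternEvent]
  rw [this]
  exact MeasurableSet.iInter fun t => h t (measurable_quantize b (measurableSet_singleton _))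

/-- The window of length `l` of the quantized process starting at time `j`. -/
def quantWindow {𝒳 : Set ℝ} (hX𝒳 : ∀ i ω, X i ω ∈ 𝒳) (b l j : ℕ) (ω : Ω) :
    Fin l → quantAlphabet 𝒳 b :=
  fun t => ⟨quantize b (X (j + t) ω), X (j + t) ω, hX𝒳 _ ω, rfl⟩

theorem quantWindow_eq_iff {𝒳 : Set ℝ} (hX𝒳 : ∀ i ω, X i ω ∈ 𝒳) (b l j : ℕ) (ω : Ω)
    (a : Fin l → quantAlphabet 𝒳 b) :
    a = quantWindow hX𝒳 b l j ω ↔ ω ∈ patternEvent X b j (fun t => (a t : ℝ)) := by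
  simp only [quantWindow, patternEvent, funext_iff, Subtype.ext_iff, Set.mem_ofPred_eq]
  exact forall_congr' fun t => eq_comm

theorem measurableSet_past_patternEvent (b j J : ℕ) {l : ℕ} (a : Fin l → ℝ) (h : j + l ≤ J + 1) :
    MeasurableSet[past X J] (patternEvent X b j a) := by
  refine measurableSet_patternEvent_of b j a fun t => ?_
  refine Measurable.mono (comap_measurable (X (j + t))) ?_ le_rfl
  exact le_iSup (fun i : {i : ℕ // i ≤ J} => MeasurableSpace.comap (X i) inferInstance)
    ⟨j + t, by omega⟩

theorem measurableSet_future_patternEvent (b j J : ℕ) {l : ℕ} (a : Fin l → ℝ) (h : J ≤ j) :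
    MeasurableSet[future X J] (patternEvent X b j a) := by
  refine measurableSet_patternEvent_of b j a fun t => ?_
  refine Measurable.mono (comap_measurable (X (j + t))) ?_ le_rfl
  exact le_iSup (fun i : {i : ℕ // J ≤ i} => MeasurableSpace.comap (X i) inferInstance)
    ⟨j + t, by omega⟩

/-- A function of a window as a combination of pattern indicators. -/
theorem apply_quantWindow_eq_sum {𝒳 : Set ℝ} (hX𝒳 : ∀ i ω, X i ω ∈ 𝒳) (b : ℕ)
    [Fintype (quantAlphabet 𝒳 b)] (l j : ℕ) (f : (Fin l → quantAlphabet 𝒳 b) → ℝ) (ω : Ω) :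
    f (quantWindow hX𝒳 b l j ω) =
      ∑ a, f a * (patternEvent X b j (fun t => (a t : ℝ))).indicator 1 ω := by
  classical
  rw [Finset.sum_eq_single (quantWindow hX𝒳 b l j ω)]
  · rw [Set.indicator_of_mem ((quantWindow_eq_iff hX𝒳 b l j ω _).1 rfl)]; simp
  · intro a _ ha
    rw [Set.indicator_of_notMem (fun h => ha ((quantWindow_eq_iff hX𝒳 b l j ω _).2 h)), mul_zero]
  · intro h; exact absurd (Finset.mem_univ _) h

variable [MeasurableSpace Ω] {μ : Measure Ω}

theorem measurableSet_patternEvent (hX : ∀ i, Measurable (X i)) (b j : ℕ) {l : ℕ}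
    (a : Fin l → ℝ) : MeasurableSet (patternEvent X b j a) :=
  measurableSet_patternEvent_of b j a fun _ => hX _

theorem IsStationary.measureReal_patternEvent (hstat : IsStationary X μ) (b j : ℕ) {l : ℕ}
    (a : Fin l → ℝ) : μ.real (patternEvent X b j a) = μ.real (patternEvent X b 0 a) := by
  have hs : MeasurableSet {x : ℕ → ℝ | ∀ t : Fin l, quantize b (x t) = a t} := by
    rw [Set.ofPred_forall]
    exact MeasurableSet.iInter fun t =>
      ((measurable_quantize b).comp (measurable_pi_apply _)) (measurableSet_singleton (a t))
  have h := (hstat j).measure_mem_eq hs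
  unfold Measure.real
  congr 1
  convert h using 2
  · ext ω; simp [patternEvent, add_comm]
  · ext ω; simp [patternEvent]

/-- `ψ*`-mixing bounds the joint probability of two separated patterns. -/
theorem measureReal_patternEvent_inter_le [IsProbabilityMeasure μ] {g : ℕ} {η : ℝ} (hη : 0 ≤ η)
    (hg : psiStar X μ g ≤ ENNReal.ofReal (1 + η)) (b i j : ℕ) {l : ℕ} (hij : i + l + g ≤ j + 1)
    (hl : 0 < l) (a a' : Fin l → ℝ) :
    μ.real (patternEvent X b i a ∩ patternEvent X b j a') ≤
      (1 + η) * (μ.real (patternEvent X b i a) * μ.real (patternEvent X b j a')) := by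
  set A := patternEvent X b i a
  set B := patternEvent X b j a'
  have hmain : μ (A ∩ B) ≤ ENNReal.ofReal (1 + η) * (μ A * μ B) := by
    by_cases h0 : μ A * μ B = 0
    · rcases mul_eq_zero.1 h0 with h | h
      · exact (measure_mono Set.inter_subset_left).trans (by rw [h]; exact zero_le)
      · exact (measure_mono Set.inter_subset_right).trans (by rw [h]; exact zero_le)
    · have h1 : μ (A ∩ B) / (μ A * μ B) ≤ psiStar X μ g := by
        unfold psiStar
        -- The last time read by the first pattern is `i + l - 1`; `hl` makes this subtraction
        -- genuine, so the second pattern starts at least `g` later.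
        refine le_iSup_of_le (i + l - 1) (le_iSup_of_le A (le_iSup_of_le B
          (le_iSup_of_le ?_ (le_iSup_of_le ?_ (le_iSup_of_le (pos_iff_ne_zero.2 h0) le_rfl)))))
        · exact measurableSet_past_patternEvent b i _ a (by omega)
        · exact measurableSet_future_patternEvent b j _ a' (by omega)
      exact (ENNReal.div_le_iff h0 (ENNReal.mul_ne_top (measure_ne_top _ _)
        (measure_ne_top _ _))).1 (h1.trans hg)
  have h2 := ENNReal.toReal_mono (ENNReal.mul_ne_top ENNReal.ofReal_ne_top
    (ENNReal.mul_ne_top (measure_ne_top _ _) (measure_ne_top _ _))) hmain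
  rw [ENNReal.toReal_mul, ENNReal.toReal_mul, ENNReal.toReal_ofReal (by linarith)] at h2
  exact h2

section LLN

variable {𝒳 : Set ℝ} (hX𝒳 : ∀ i ω, X i ω ∈ 𝒳) (b : ℕ) [Fintype (quantAlphabet 𝒳 b)]

theorem measurable_apply_quantWindow (hX : ∀ i, Measurable (X i)) (l j : ℕ)
    (f : (Fin l → quantAlphabet 𝒳 b) → ℝ) :
    Measurable fun ω => f (quantWindow hX𝒳 b l j ω) := by
  simp only [apply_quantWindow_eq_sum]
  exact Finset.measurable_sum _ fun a _ =>
    (measurable_const.indicator (measurableSet_patternEvent hX b j _)).const_mul _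

variable [IsProbabilityMeasure μ]

theorem integrable_indicator_patternEvent (hX : ∀ i, Measurable (X i)) (j : ℕ) {l : ℕ}
    (a : Fin l → ℝ) : Integrable ((patternEvent X b j a).indicator (1 : Ω → ℝ)) μ :=
  (integrable_const 1).indicator (measurableSet_patternEvent hX b j _)

theorem integral_apply_quantWindow (hX : ∀ i, Measurable (X i)) (hstat : IsStationary X μ)
    (l j : ℕ) (f : (Fin l → quantAlphabet 𝒳 b) → ℝ) :
    ∫ ω, f (quantWindow hX𝒳 b l j ω) ∂μ =
      ∑ a, f a * μ.real (patternEvent X b 0 (fun t => (a t : ℝ))) := by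
  simp only [apply_quantWindow_eq_sum]
  rw [integral_finsetSum _ fun a _ =>
    (integrable_indicator_patternEvent b hX j _).const_mul _]
  refine Finset.sum_congr rfl fun a _ => ?_
  rw [integral_const_mul, integral_indicator_one (measurableSet_patternEvent hX b j _),
    hstat.measureReal_patternEvent]

/-- Expanding `f` in pattern indicators reduces this to pairs of patterns. The mixing coefficient
gives only an upper bound for each pair, so the coefficients `f a * f a'` must be nonnegative. -/
theorem integral_mul_quantWindow_le (hX : ∀ i, Measurable (X i)) (hstat : IsStationary X μ)
    {g : ℕ} {η : ℝ} (hη : 0 ≤ η) (hg : psiStar X μ g ≤ ENNReal.ofReal (1 + η))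
    (l i j : ℕ) (hl : 0 < l) (hij : i + l + g ≤ j + 1)
    (f : (Fin l → quantAlphabet 𝒳 b) → ℝ) (hf : ∀ a, 0 ≤ f a) :
    ∫ ω, f (quantWindow hX𝒳 b l i ω) * f (quantWindow hX𝒳 b l j ω) ∂μ ≤
      (1 + η) * (∑ a, f a * μ.real (patternEvent X b 0 (fun t => (a t : ℝ)))) ^ 2 := by
  simp only [apply_quantWindow_eq_sum hX𝒳 b l i f, apply_quantWindow_eq_sum hX𝒳 b l j f,
    Finset.sum_mul_sum]
  have hind : ∀ (a a' : Fin l → quantAlphabet 𝒳 b) (ω : Ω),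
      f a * (patternEvent X b i (fun t => (a t : ℝ))).indicator 1 ω *
        (f a' * (patternEvent X b j (fun t => (a' t : ℝ))).indicator 1 ω) =
      f a * f a' * (patternEvent X b i (fun t => (a t : ℝ)) ∩
        patternEvent X b j (fun t => (a' t : ℝ))).indicator (1 : Ω → ℝ) ω := by
    intro a a' ω
    rw [Set.inter_indicator_one, Pi.mul_apply]
    ring
  have hmeas : ∀ (a a' : Fin l → quantAlphabet 𝒳 b),
      MeasurableSet (patternEvent X b i (fun t => (a t : ℝ)) ∩
        patternEvent X b j (fun t => (a' t : ℝ))) := fun a a' =>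
    (measurableSet_patternEvent hX b i _).inter (measurableSet_patternEvent hX b j _)
  simp only [hind]
  have hint : ∀ (a a' : Fin l → quantAlphabet 𝒳 b), Integrable (fun ω =>
      f a * f a' * (patternEvent X b i (fun t => (a t : ℝ)) ∩
        patternEvent X b j (fun t => (a' t : ℝ))).indicator (1 : Ω → ℝ) ω) μ := fun a a' =>
    ((integrable_const (1 : ℝ)).indicator (hmeas a a')).const_mul _
  rw [integral_finsetSum _ fun a _ => integrable_finsetSum _ fun a' _ => hint a a', sq,
    Finset.sum_mul_sum, Finset.mul_sum]
  refine Finset.sum_le_sum fun a _ => ?_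
  rw [integral_finsetSum _ fun a' _ => hint a a', Finset.mul_sum]
  refine Finset.sum_le_sum fun a' _ => ?_
  rw [integral_const_mul, integral_indicator_one (hmeas a a')]
  have h := measureReal_patternEvent_inter_le hη hg b i j hij hl (fun t => (a t : ℝ))
    (fun t => (a' t : ℝ))
  rw [hstat.measureReal_patternEvent b i, hstat.measureReal_patternEvent b j] at h
  calc f a * f a' * _ ≤ f a * f a' * _ :=
        mul_le_mul_of_nonneg_left h (mul_nonneg (hf a) (hf a'))
    _ = _ := by ring

/-- A weak law of large numbers for averages of a function of the windows of the quantized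
process, with an explicit rate. -/
theorem measure_average_quantWindow_ge_le (hX : ∀ i, Measurable (X i)) (hstat : IsStationary X μ)
    {g : ℕ} {η : ℝ} (hη : 0 ≤ η) (hg : psiStar X μ g ≤ ENNReal.ofReal (1 + η))
    (l s M : ℕ) (hl : 0 < l) (hM : 0 < M) (f : (Fin l → quantAlphabet 𝒳 b) → ℝ)
    (hf : ∀ a, 0 ≤ f a) (L : ℝ) (hfL : ∀ a, f a ≤ L) (e t : ℝ) (ht : 0 < t)
    (he : ∑ a, f a * μ.real (patternEvent X b 0 (fun t => (a t : ℝ))) ≤ e) :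
    μ {ω | e + t ≤ (∑ j : Fin M, f (quantWindow hX𝒳 b l (s + j) ω)) / M} ≤
      ENNReal.ofReal ((η * L ^ 2 + 2 * (l + g) * L ^ 2 / M) / t ^ 2) := by
  set Z : ℕ → Ω → ℝ := fun j ω => f (quantWindow hX𝒳 b l j ω) with hZ
  set e₀ := ∑ a, f a * μ.real (patternEvent X b 0 (fun t => (a t : ℝ))) with he₀
  have hZm : ∀ j, Measurable (Z j) := fun j => measurable_apply_quantWindow hX𝒳 b hX l j f
  have hZ0 : ∀ j ω, 0 ≤ Z j ω := fun j ω => hf _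
  have hZL : ∀ j ω, Z j ω ≤ L := fun j ω => hfL _
  have hL : 0 ≤ L := by
    obtain ⟨ω⟩ : Nonempty Ω := nonempty_of_isProbabilityMeasure μ
    exact (hZ0 0 ω).trans (hZL 0 ω)
  have hZb : ∀ j ω, ‖Z j ω‖ ≤ L := fun j ω => by
    rw [Real.norm_eq_abs, abs_of_nonneg (hZ0 j ω)]; exact hZL j ω
  have hZi : ∀ j, Integrable (Z j) μ := fun j =>
    Integrable.of_bound (hZm j).aestronglyMeasurable L (ae_of_all _ (hZb j))
  have hZZi : ∀ i j, Integrable (fun ω => Z i ω * Z j ω) μ := fun i j =>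
    (hZi j).bdd_mul (hZm i).aestronglyMeasurable (ae_of_all _ (hZb i))
  have hEZ : ∀ j, ∫ ω, Z j ω ∂μ = e₀ := fun j =>
    integral_apply_quantWindow hX𝒳 b hX hstat l j f
  have he₀0 : 0 ≤ e₀ := by rw [← hEZ 0]; exact integral_nonneg (hZ0 0)
  have he₀L : e₀ ≤ L := by
    rw [← hEZ 0]
    calc ∫ ω, Z 0 ω ∂μ ≤ ∫ ω, L ∂μ := integral_mono (hZi 0) (integrable_const _) (hZL 0)
      _ = L := by simp
  -- Pairs separated by the gap satisfy the mixing bound; overlapping or close pairs are bounded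
  -- crudely by `L ^ 2`.
  have hEZZ : ∀ i j, ∫ ω, Z i ω * Z j ω ∂μ ≤ (1 + η) * e₀ ^ 2 +
      if i + l + g ≤ j + 1 ∨ j + l + g ≤ i + 1 then 0 else L ^ 2 := by
    intro i j
    split_ifs with h
    · rw [add_zero]
      rcases h with h | h
      · exact integral_mul_quantWindow_le hX𝒳 b hX hstat hη hg l i j hl h f hf
      · simp_rw [mul_comm (Z i _)]
        exact integral_mul_quantWindow_le hX𝒳 b hX hstat hη hg l j i hl h f hf
    · refine le_add_of_nonneg_of_le (by positivity) ?_
      calc ∫ ω, Z i ω * Z j ω ∂μ ≤ ∫ ω, L ^ 2 ∂μ := integral_mono (hZZi i j) (integrable_const _)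
            fun ω => by
              change Z i ω * Z j ω ≤ L ^ 2
              rw [sq]; exact mul_le_mul (hZL _ _) (hZL _ _) (hZ0 _ _) hL
        _ = L ^ 2 := by simp
  set T : Ω → ℝ := fun ω => ∑ j : Fin M, Z (s + j) ω with hT
  have hTm : Measurable T := Finset.measurable_sum _ fun j _ => hZm _
  have hET : ∫ ω, T ω ∂μ = M * e₀ := by
    rw [hT, integral_finsetSum _ fun j _ => hZi _]
    simp [hEZ]
  have hTL : MemLp T 2 μ := by
    refine MemLp.of_bound hTm.aestronglyMeasurable (M * L) (ae_of_all _ fun ω => ?_)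
    refine (norm_sum_le _ _).trans ((Finset.sum_le_sum fun j _ => hZb _ ω).trans ?_)
    simp
  have hET2 : ∫ ω, T ω ^ 2 ∂μ ≤ M ^ 2 * ((1 + η) * e₀ ^ 2) + 2 * (l + g) * L ^ 2 * M := by
    have h1 : ∀ ω, T ω ^ 2 = ∑ i : Fin M, ∑ j : Fin M, Z (s + i) ω * Z (s + j) ω := by
      intro ω; rw [sq, hT, Finset.sum_mul_sum]
    simp only [h1]
    rw [integral_finsetSum _ fun i _ => integrable_finsetSum _ fun j _ => hZZi _ _]
    have h2 : ∀ i : Fin M, ∫ ω, ∑ j : Fin M, Z (s + i) ω * Z (s + j) ω ∂μ ≤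
        M * ((1 + η) * e₀ ^ 2) + 2 * (l + g) * L ^ 2 := by
      intro i
      rw [integral_finsetSum _ fun j _ => hZZi _ _]
      refine (Finset.sum_le_sum fun (j : Fin M) _ => hEZZ (s + i) (s + (j : ℕ))).trans ?_
      rw [Finset.sum_add_distrib]
      refine add_le_add (by simp) ?_
      rw [Finset.sum_ite, Finset.sum_const_zero, zero_add, Finset.sum_const, nsmul_eq_mul]
      refine mul_le_mul_of_nonneg_right ?_ (sq_nonneg L)
      -- Each `i` has at most `2 (l + g)` close partners, so they contribute only order `M` to a
      -- second moment of order `M ^ 2`.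
      have h3 : (Finset.univ.filter fun j : Fin M =>
          ¬(s + (i : ℕ) + l + g ≤ s + j + 1 ∨ s + (j : ℕ) + l + g ≤ s + i + 1)).card ≤
          (Finset.Ico ((i : ℕ) + 1 - (l + g)) (i + (l + g))).card := by
        refine Finset.card_le_card_of_injOn (fun j => (j : ℕ)) ?_ Fin.val_injective.injOn
        intro j hj
        simp only [Finset.coe_filter, Finset.mem_univ, true_and, Set.mem_ofPred_eq] at hj
        simp only [Finset.coe_Ico, Set.mem_Ico]
        omega
      rw [Nat.card_Ico] at h3
      have h4 : (i : ℕ) + (l + g) - (i + 1 - (l + g)) ≤ 2 * (l + g) := by omega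
      exact_mod_cast h3.trans h4
    refine (Finset.sum_le_sum fun i _ => h2 i).trans (le_of_eq ?_)
    simp
    ring
  have hvar : Var[T; μ] ≤ M ^ 2 * (η * L ^ 2) + 2 * (l + g) * L ^ 2 * M := by
    rw [variance_eq_sub hTL]
    have h5 : ∫ ω, (T ^ 2) ω ∂μ = ∫ ω, T ω ^ 2 ∂μ := rfl
    rw [h5, hET]
    -- Subtracting the squared mean removes `M² e₀²`; the mixing excess `η M² e₀²` survives.
    have h6 : (M : ℝ) ^ 2 * (η * e₀ ^ 2) ≤ M ^ 2 * (η * L ^ 2) := by gcongr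
    nlinarith
  have hM' : (0 : ℝ) < M := by exact_mod_cast hM
  have hch := meas_ge_le_variance_div_sq hTL (c := M * t) (by positivity)
  refine (measure_mono fun ω hω => ?_).trans (hch.trans (ENNReal.ofReal_le_ofReal ?_))
  · simp only [Set.mem_ofPred_eq] at hω ⊢
    rw [le_div_iff₀ hM'] at hω
    rw [hET]
    refine le_trans ?_ (le_abs_self _)
    change M * t ≤ (∑ j : Fin M, f (quantWindow hX𝒳 b l (s + j) ω)) - M * e₀
    nlinarith
  · rw [div_le_div_iff₀ (by positivity) (by positivity)]
    have h7 : (η * L ^ 2 + 2 * (l + g) * L ^ 2 / M) * (M * t) ^ 2 =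
        (M ^ 2 * (η * L ^ 2) + 2 * (l + g) * L ^ 2 * M) * t ^ 2 := by
      field_simp
    rw [h7]
    gcongr

end LLN

end QuantizedSource

/-! ### Code length of the source and its conditional entropy -/

section SourceCoding

variable {Ω : Type*} {X : ℕ → Ω → ℝ}

theorem patternEvent_subset_init (b : ℕ) {l : ℕ} (a : Fin (l + 1) → ℝ) :
    patternEvent X b 0 a ⊆ patternEvent X b 0 (fun t : Fin l => a t.castSucc) :=
  fun _ hω t => hω t.castSucc

variable [MeasurableSpace Ω] {μ : Measure Ω}

/-- The conditional probabilities of order `l` of the quantized process, mixed with the uniform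
distribution. -/
def smoothKernel (μ : Measure Ω) (X : ℕ → Ω → ℝ) (𝒳 : Set ℝ) (b l : ℕ)
    [Fintype (quantAlphabet 𝒳 b)] (a : Fin (l + 1) → quantAlphabet 𝒳 b) : ℝ :=
  1 / 2 * (μ.real (patternEvent X b 0 (fun t => (a t : ℝ))) /
      μ.real (patternEvent X b 0 (fun t : Fin l => (a t.castSucc : ℝ)))) +
    1 / 2 * (Fintype.card (quantAlphabet 𝒳 b) : ℝ)⁻¹

/-- The uniform half is there for this bound: code lengths are finite and at most `1 + log₂ |𝒳_b|`,
as the weak law requires, at the price of one bit on average. -/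
theorem smoothKernel_ge (𝒳 : Set ℝ) (b l : ℕ) [Fintype (quantAlphabet 𝒳 b)]
    (a : Fin (l + 1) → quantAlphabet 𝒳 b) :
    1 / 2 * (Fintype.card (quantAlphabet 𝒳 b) : ℝ)⁻¹ ≤ smoothKernel μ X 𝒳 b l a := by
  unfold smoothKernel
  have : 0 ≤ μ.real (patternEvent X b 0 (fun t => (a t : ℝ))) /
      μ.real (patternEvent X b 0 (fun t : Fin l => (a t.castSucc : ℝ))) := by positivity
  linarith

variable [IsProbabilityMeasure μ]

theorem sum_measureReal_patternEvent_snoc_le (hX : ∀ i, Measurable (X i)) (𝒳 : Set ℝ) (b : ℕ)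
    [Fintype (quantAlphabet 𝒳 b)] {l : ℕ} (c : Fin l → quantAlphabet 𝒳 b) :
    ∑ x, μ.real (patternEvent X b 0
        (fun t => ((Fin.snoc c x : Fin (l + 1) → quantAlphabet 𝒳 b) t : ℝ))) ≤
      μ.real (patternEvent X b 0 (fun t => (c t : ℝ))) := by
  rw [← measureReal_biUnion_finset]
  · refine measureReal_mono (Set.iUnion₂_subset fun x _ => ?_)
    refine (patternEvent_subset_init b _).trans (le_of_eq ?_)
    congr 1
    ext t
    rw [Fin.snoc_castSucc]
  · intro x _ y _ hxy
    refine Set.disjoint_left.2 fun ω h1 h2 => hxy ?_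
    have h1 := h1 (Fin.last l)
    have h2 := h2 (Fin.last l)
    simp only [Fin.snoc_last] at h1 h2
    exact Subtype.ext (h1.symm.trans h2)
  · exact fun x _ => measurableSet_patternEvent hX b 0 _

theorem isSubKernel_smoothKernel (hX : ∀ i, Measurable (X i)) (𝒳 : Set ℝ) (b l : ℕ)
    [Fintype (quantAlphabet 𝒳 b)] : IsSubKernel (smoothKernel μ X 𝒳 b l) := by
  refine ⟨fun a => by unfold smoothKernel; positivity, fun c => ?_⟩
  simp only [smoothKernel, Fin.snoc_castSucc]
  rw [Finset.sum_add_distrib, ← Finset.mul_sum, ← Finset.sum_div, Finset.sum_const,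
    Finset.card_univ, nsmul_eq_mul]
  have h1 : (∑ x, μ.real (patternEvent X b 0
      (fun t => ((Fin.snoc c x : Fin (l + 1) → quantAlphabet 𝒳 b) t : ℝ)))) /
      μ.real (patternEvent X b 0 (fun t => (c t : ℝ))) ≤ 1 :=
    div_le_one_of_le₀ (sum_measureReal_patternEvent_snoc_le hX 𝒳 b c) (by positivity)
  have h2 : (Fintype.card (quantAlphabet 𝒳 b) : ℝ) * (Fintype.card (quantAlphabet 𝒳 b) : ℝ)⁻¹ ≤ 1 :=
    mul_inv_le_one
  linarith

theorem mul_logb_div_nonneg (b : ℕ) {l : ℕ} (a : Fin (l + 1) → ℝ) :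
    0 ≤ μ.real (patternEvent X b 0 a) *
      Real.logb 2 (μ.real (patternEvent X b 0 (fun t : Fin l => a t.castSucc)) /
        μ.real (patternEvent X b 0 a)) := by
  have h1 : μ.real (patternEvent X b 0 a) ≤
      μ.real (patternEvent X b 0 (fun t : Fin l => a t.castSucc)) :=
    measureReal_mono (patternEvent_subset_init b a)
  rcases (measureReal_nonneg (μ := μ) (s := patternEvent X b 0 a)).eq_or_lt with h | h
  · rw [← h, zero_mul]
  · exact mul_nonneg h.le (Real.logb_nonneg (by norm_num) ((one_le_div h).2 h1))

/-- `condEntropy` sums nonnegative terms over all real contexts and symbols; patterns over the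
alphabet embed injectively among them. -/
theorem sum_mul_logb_le_condEntropy (𝒳 : Set ℝ) (b l : ℕ) [Fintype (quantAlphabet 𝒳 b)] :
    ENNReal.ofReal (∑ a : Fin (l + 1) → quantAlphabet 𝒳 b,
      μ.real (patternEvent X b 0 (fun t => (a t : ℝ))) *
        Real.logb 2 (μ.real (patternEvent X b 0 (fun t : Fin l => (a t.castSucc : ℝ))) /
          μ.real (patternEvent X b 0 (fun t => (a t : ℝ))))) ≤
      condEntropy (fun ω => quantize b (X l ω)) (fun ω => quantVec b (initial X l ω)) μ := by
  rw [ENNReal.ofReal_sum_of_nonneg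
    fun a _ => mul_logb_div_nonneg (l := l) b (fun t => (a t : ℝ)), ← tsum_fintype (L := .unconditional _)]
  unfold condEntropy
  set F : (Fin (l + 1) → quantAlphabet 𝒳 b) → (Fin l → ℝ) × ℝ :=
    fun a => (fun t => (a t.castSucc : ℝ), (a (Fin.last l) : ℝ)) with hF
  have hinj : Function.Injective F := by
    intro a a' h
    simp only [hF, Prod.mk.injEq, funext_iff] at h
    ext t
    refine Fin.lastCases h.2 (fun i => h.1 i) t
  refine le_trans (le_of_eq (tsum_congr fun a => ?_)) (ENNReal.tsum_comp_le_tsum_of_injective hinj _)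
  have h1 : {ω | quantVec b (initial X l ω) = (F a).1} =
      patternEvent X b 0 (fun t : Fin l => (a t.castSucc : ℝ)) := by
    ext ω
    simp [hF, quantVec, initial, patternEvent, funext_iff]
  have h2 : {ω | quantVec b (initial X l ω) = (F a).1 ∧ quantize b (X l ω) = (F a).2} =
      patternEvent X b 0 (fun t => (a t : ℝ)) := by
    ext ω
    simp [hF, quantVec, initial, patternEvent, funext_iff, Fin.forall_fin_succ']
  rw [h1, h2]

theorem sum_measureReal_patternEvent_eq_one {𝒳 : Set ℝ} (hX𝒳 : ∀ i ω, X i ω ∈ 𝒳)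
    (hX : ∀ i, Measurable (X i)) (b l : ℕ) [Fintype (quantAlphabet 𝒳 b)] :
    ∑ a : Fin l → quantAlphabet 𝒳 b, μ.real (patternEvent X b 0 (fun t => (a t : ℝ))) = 1 := by
  have h := apply_quantWindow_eq_sum hX𝒳 b l 0 (fun _ => (1 : ℝ))
  have h2 : ∫ ω, (1 : ℝ) ∂μ = ∫ ω, ∑ a : Fin l → quantAlphabet 𝒳 b,
      (1 : ℝ) * (patternEvent X b 0 (fun t => (a t : ℝ))).indicator 1 ω ∂μ :=
    integral_congr_ae (ae_of_all _ h)
  rw [integral_finsetSum _ fun a _ =>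
    (integrable_indicator_patternEvent b hX 0 _).const_mul _] at h2
  simp only [one_mul, integral_indicator_one (measurableSet_patternEvent hX b 0 _)] at h2
  rw [← h2]
  simp

/-- The expected code length of the smoothed kernel is at most one bit more than the conditional
entropy. -/
theorem sum_neg_logb_smoothKernel_le {𝒳 : Set ℝ} (hX𝒳 : ∀ i ω, X i ω ∈ 𝒳)
    (hX : ∀ i, Measurable (X i)) (b l : ℕ) [Fintype (quantAlphabet 𝒳 b)] (h : ℝ) (h0 : 0 ≤ h)
    (hh : condEntropy (fun ω => quantize b (X l ω)) (fun ω => quantVec b (initial X l ω)) μ ≤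
      ENNReal.ofReal h) :
    ∑ a, -Real.logb 2 (smoothKernel μ X 𝒳 b l a) *
      μ.real (patternEvent X b 0 (fun t => (a t : ℝ))) ≤ 1 + h := by
  have h1 := (ENNReal.ofReal_le_ofReal_iff h0).1
    ((sum_mul_logb_le_condEntropy (μ := μ) (X := X) 𝒳 b l).trans hh)
  rw [← sum_measureReal_patternEvent_eq_one (μ := μ) hX𝒳 hX b (l + 1)]
  refine le_trans ?_ (add_le_add_right h1 _)
  rw [← Finset.sum_add_distrib]
  refine Finset.sum_le_sum fun a _ => ?_
  set p := μ.real (patternEvent X b 0 (fun t => (a t : ℝ)))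
  have hp' : p ≤ μ.real (patternEvent X b 0 (fun t : Fin l => (a t.castSucc : ℝ))) :=
    measureReal_mono (patternEvent_subset_init b fun t => (a t : ℝ))
  set P := μ.real (patternEvent X b 0 (fun t : Fin l => (a t.castSucc : ℝ)))
  rcases (measureReal_nonneg : 0 ≤ p).eq_or_lt with hp | hp
  · have hp : p = 0 := hp.symm
    rw [hp]; simp
  · have hP : 0 < P := hp.trans_le hp'
    have h2 : p / P / 2 ≤ smoothKernel μ X 𝒳 b l a := by
      have : (0 : ℝ) ≤ (Fintype.card (quantAlphabet 𝒳 b) : ℝ)⁻¹ := by positivity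
      change p / P / 2 ≤ 1 / 2 * (p / P) + 1 / 2 * (Fintype.card (quantAlphabet 𝒳 b) : ℝ)⁻¹
      linarith
    have h3 : -Real.logb 2 (smoothKernel μ X 𝒳 b l a) ≤ 1 + Real.logb 2 (P / p) := by
      have h4 := Real.logb_le_logb_of_le (b := 2) (by norm_num) (by positivity) h2
      rw [Real.logb_div (by positivity) (by norm_num), Real.logb_self_eq_one (by norm_num),
        ← inv_div, Real.logb_inv] at h4
      linarith
    nlinarith

/-- With high probability the ideal cost of the quantized source is close to its conditional
entropy of any fixed order. -/
theorem measure_linCost_idealWeight_gt_le {𝒳 : Set ℝ} (hX𝒳 : ∀ i ω, X i ω ∈ 𝒳)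
    (hX : ∀ i, Measurable (X i)) (hstat : IsStationary X μ) {g : ℕ} {η : ℝ} (hη : 0 ≤ η)
    (hg : psiStar X μ g ≤ ENNReal.ofReal (1 + η)) (b l k n : ℕ) [Fintype (quantAlphabet 𝒳 b)]
    (hl : l ≤ k) (hn : k + 1 < n) (h : ℝ) (h0 : 0 ≤ h)
    (hh : condEntropy (fun ω => quantize b (X l ω)) (fun ω => quantVec b (initial X l ω)) μ ≤
      ENNReal.ofReal h) (t : ℝ) (ht : 0 < t) (L : ℝ)
    (hL : L = 1 + Real.logb 2 (Fintype.card (quantAlphabet 𝒳 b))) :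
    μ {ω | ¬ linCost 𝒳 b k (idealWeight 𝒳 b k (initial X n ω)) (quantVec b (initial X n ω)) ≤
      ENNReal.ofReal (1 + h + t)} ≤
      ENNReal.ofReal ((η * L ^ 2 + 2 * ((l + 1 : ℕ) + g) * L ^ 2 / (n - (k + 1) : ℕ)) / t ^ 2) := by
  obtain ⟨ω₀⟩ : Nonempty Ω := nonempty_of_isProbabilityMeasure μ
  have hcard : 0 < Fintype.card (quantAlphabet 𝒳 b) :=
    Fintype.card_pos_iff.2 ⟨⟨quantize b (X 0 ω₀), X 0 ω₀, hX𝒳 _ _, rfl⟩⟩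
  have hcard' : (0 : ℝ) < Fintype.card (quantAlphabet 𝒳 b) := by exact_mod_cast hcard
  set f : (Fin (l + 1) → quantAlphabet 𝒳 b) → ℝ :=
    fun a => -Real.logb 2 (smoothKernel μ X 𝒳 b l a) with hf
  have hker := isSubKernel_smoothKernel (μ := μ) hX 𝒳 b l
  have hpos : ∀ a, 0 < smoothKernel μ X 𝒳 b l a := fun a =>
    lt_of_lt_of_le (by positivity) (smoothKernel_ge 𝒳 b l a)
  have hf0 : ∀ a, 0 ≤ f a := fun a =>
    neg_nonneg.2 (Real.logb_nonpos (by norm_num) (hker.1 a) (hker.le_one a))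
  have hfL : ∀ a, f a ≤ L := by
    intro a
    have h4 := Real.logb_le_logb_of_le (b := 2) (by norm_num) (by positivity)
      (smoothKernel_ge (μ := μ) (X := X) 𝒳 b l a)
    rw [Real.logb_mul (by norm_num) (by positivity), Real.logb_inv, one_div, Real.logb_inv,
      Real.logb_self_eq_one (by norm_num)] at h4
    simp only [hf]
    linarith
  have hM : 0 < n - (k + 1) := by omega
  refine le_trans (measure_mono fun ω hω => ?_)
    (measure_average_quantWindow_ge_le hX𝒳 b hX hstat hη hg (l + 1) (k - l) (n - (k + 1))
      (Nat.succ_pos l) hM f hf0 L hfL (1 + h) t ht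
      (sum_neg_logb_smoothKernel_le hX𝒳 hX b l h h0 hh))
  simp only [Set.mem_ofPred_eq] at hω ⊢
  by_contra hlt
  apply hω
  push Not at hlt
  -- A kernel of order `l` that ignores the first `k - l` symbols is a kernel of order `k`, hence a
  -- competitor in Gibbs' inequality. This lets `k` grow while `l` stays fixed, and explains the
  -- starting offset `k - l` in the weak law.
  set q : (Fin (k + 1) → quantAlphabet 𝒳 b) → ℝ :=
    fun a => smoothKernel μ X 𝒳 b l (fun t => a ⟨k - l + t, by omega⟩) with hq
  have hqk : IsSubKernel q := by
    refine ⟨fun a => hker.1 _, fun c => ?_⟩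
    have h5 : ∀ x, (fun t : Fin (l + 1) => (Fin.snoc c x : Fin (k + 1) → quantAlphabet 𝒳 b)
        ⟨k - l + t, by omega⟩) =
        (Fin.snoc (fun t : Fin l => c ⟨k - l + t, by omega⟩) x :
          Fin (l + 1) → quantAlphabet 𝒳 b) := by
      intro x
      ext1 t
      refine Fin.lastCases ?_ (fun i => ?_) t
      · rw [Fin.snoc_last]
        have : (⟨k - l + (Fin.last l : Fin (l + 1)), by simp; omega⟩ : Fin (k + 1)) =
          Fin.last k := by ext; simp; omega
        rw [this, Fin.snoc_last]
      · rw [Fin.snoc_castSucc]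
        have : (⟨k - l + (i.castSucc : Fin (l + 1)), by simp; omega⟩ : Fin (k + 1)) =
          Fin.castSucc ⟨k - l + i, by omega⟩ := rfl
        rw [this, Fin.snoc_castSucc]
    simp only [hq, h5]
    exact hker.2 _
  set v : Fin n → quantAlphabet 𝒳 b :=
    fun i => ⟨quantize b (X i ω), X i ω, hX𝒳 _ ω, rfl⟩ with hv
  have hgibbs := linCost_empWeight_self_le 𝒳 b k v q hqk fun a => hpos _
  refine hgibbs.trans (ENNReal.ofReal_le_ofReal (le_trans (le_of_eq ?_) hlt.le))
  congr 1
  refine Finset.sum_congr rfl fun j _ => ?_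
  change f _ = f _
  congr 1
  ext t
  simp only [window, hv, quantWindow]
  congr 2
  omega

end SourceCoding

/-! ### Quantization error, alphabet size and consequences of minimality -/

theorem abs_sub_quantize_le (b : ℕ) (x : ℝ) : |x - quantize b x| ≤ ((2 : ℝ) ^ b)⁻¹ := by
  have hp : (0 : ℝ) < 2 ^ b := by positivity
  rw [quantize_eq]
  have h1 := Int.floor_le ((2 : ℝ) ^ b * x)
  have h2 := Int.lt_floor_add_one ((2 : ℝ) ^ b * x)
  have h3 : x - (⌊(2 : ℝ) ^ b * x⌋ : ℝ) / 2 ^ b =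
      ((2 : ℝ) ^ b * x - ⌊(2 : ℝ) ^ b * x⌋) / 2 ^ b := by field_simp
  rw [h3, abs_of_nonneg (div_nonneg (by linarith) hp.le), inv_eq_one_div]
  gcongr
  linarith

theorem norm2_sub_quantVec_sq_le (b : ℕ) {n : ℕ} (x : Fin n → ℝ) :
    norm2 (x - quantVec b x) ^ 2 ≤ n * ((4 : ℝ) ^ b)⁻¹ := by
  rw [norm2_sq]
  have h : ∀ i : Fin n, (x - quantVec b x) i ^ 2 ≤ ((4 : ℝ) ^ b)⁻¹ := by
    intro i
    have h1 := abs_sub_quantize_le b (x i)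
    have h2 : ((4 : ℝ) ^ b)⁻¹ = (((2 : ℝ) ^ b)⁻¹) ^ 2 := by
      rw [inv_pow, ← pow_mul, mul_comm, pow_mul]; norm_num
    rw [h2, ← sq_abs]
    exact pow_le_pow_left₀ (abs_nonneg _) h1 2
  refine (Finset.sum_le_sum fun i _ => h i).trans (le_of_eq ?_)
  simp

/-- The quantized alphabet of a bounded set has at most a constant times `2 ^ b` elements. -/
theorem exists_card_quantAlphabet_le {𝒳 : Set ℝ} (h𝒳 : Bornology.IsBounded 𝒳) :
    ∃ K : ℝ, 1 ≤ K ∧ ∀ b : ℕ, (quantAlphabet 𝒳 b).Finite ∧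
      ((quantAlphabet 𝒳 b).ncard : ℝ) ≤ K * 2 ^ b := by
  obtain ⟨B, hB⟩ := h𝒳.exists_norm_le
  obtain ⟨N, hN⟩ := exists_nat_ge B
  refine ⟨2 * N + 1, by linarith [N.cast_nonneg (α := ℝ)], fun b => ?_⟩
  have hp : (0 : ℝ) < 2 ^ b := by positivity
  set F : Finset ℝ := (Finset.Icc (-((N : ℤ) * 2 ^ b)) (N * 2 ^ b)).image
    (fun z : ℤ => (z : ℝ) / 2 ^ b) with hF
  have hsub : quantAlphabet 𝒳 b ⊆ F := by
    rintro _ ⟨x, hx, rfl⟩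
    have h1 := abs_le.1 ((Real.norm_eq_abs x ▸ hB x hx).trans hN)
    rw [hF, Finset.coe_image]
    refine ⟨⌊(2 : ℝ) ^ b * x⌋, ?_, (quantize_eq b x).symm⟩
    simp only [Finset.coe_Icc, Set.mem_Icc]
    constructor
    · rw [Int.le_floor]; push_cast; nlinarith
    · have : (⌊(2 : ℝ) ^ b * x⌋ : ℝ) ≤ N * 2 ^ b := (Int.floor_le _).trans (by nlinarith)
      exact_mod_cast this
  refine ⟨F.finite_toSet.subset hsub, ?_⟩
  have h2 : (quantAlphabet 𝒳 b).ncard ≤ 2 * N * 2 ^ b + 1 := by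
    refine (Set.ncard_le_ncard hsub F.finite_toSet).trans ?_
    rw [Set.ncard_coe_finset]
    refine Finset.card_image_le.trans ?_
    rw [Int.card_Icc]
    have : (N : ℤ) * 2 ^ b + 1 - -(N * 2 ^ b) = ((2 * N * 2 ^ b + 1 : ℕ) : ℤ) := by
      push_cast; ring
    rw [this, Int.toNat_natCast]
  have h3 : ((quantAlphabet 𝒳 b).ncard : ℝ) ≤ 2 * N * 2 ^ b + 1 := by exact_mod_cast h2
  have h4 : (1 : ℝ) ≤ 2 ^ b := one_le_pow₀ (by norm_num)
  nlinarith

/-- The cost is an average over windows, so a uniform error in the weights passes to it undiminished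
at worst. -/
theorem linCost_le_add (𝒳 : Set ℝ) (b k : ℕ) (w w' : (Fin (k + 1) → quantAlphabet 𝒳 b) → ℝ≥0∞)
    (E : ℝ≥0∞) (h : ∀ a, w a ≤ w' a + E) {n : ℕ} (u : Fin n → ℝ)
    (hu : ∀ i, u i ∈ quantAlphabet 𝒳 b) :
    linCost 𝒳 b k w u ≤ linCost 𝒳 b k w' u + E := by
  have h1 := linCost_eq_average 𝒳 b k w (fun i => (⟨u i, hu i⟩ : quantAlphabet 𝒳 b))
  have h2 := linCost_eq_average 𝒳 b k w' (fun i => (⟨u i, hu i⟩ : quantAlphabet 𝒳 b))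
  simp only at h1 h2
  rw [h1, h2]
  refine (ENNReal.div_le_div_right (Finset.sum_le_sum fun j _ => h _) _).trans ?_
  rw [Finset.sum_add_distrib, ENNReal.add_div, Finset.sum_const, Finset.card_univ,
    Fintype.card_fin, nsmul_eq_mul]
  refine add_le_add le_rfl ?_
  rw [mul_comm, mul_div_assoc]
  exact mul_le_of_le_one_right' ENNReal.div_self_le_one

/-- The deterministic consequence of minimality: a minimizer has small ideal cost and small
residual. -/
theorem IsAMEPMinimizer.cost_bounds {𝒳 : Set ℝ} {b k : ℕ}
    {w : (Fin (k + 1) → quantAlphabet 𝒳 b) → ℝ≥0∞} {lam : ℝ} {m n : ℕ}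
    {A : Matrix (Fin m) (Fin n) ℝ} {x v : Fin n → ℝ} (hx : ∀ i, x i ∈ 𝒳)
    (hv : IsAMEPMinimizer 𝒳 b k w lam A (A.mulVec x) v) {E G H : ℝ} (hE : 0 ≤ E) (hG : 0 ≤ G)
    (hH : 0 ≤ H) (h1 : weightDist w (idealWeight 𝒳 b k x) ≤ ENNReal.ofReal E)
    (h2 : lam / (n : ℝ) ^ 2 * norm2 (A.mulVec (x - quantVec b x)) ^ 2 ≤ G)
    (h3 : linCost 𝒳 b k (idealWeight 𝒳 b k x) (quantVec b x) ≤ ENNReal.ofReal H) :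
    linCost 𝒳 b k (idealWeight 𝒳 b k x) v ≤ ENNReal.ofReal (H + G + 2 * E) ∧
      lam / (n : ℝ) ^ 2 * norm2 (A.mulVec (v - x)) ^ 2 ≤ H + G + 2 * E := by
  have hq : ∀ i, quantVec b x i ∈ quantAlphabet 𝒳 b := fun i => ⟨x i, hx i, rfl⟩
  have hd : ∀ a, w a ≤ idealWeight 𝒳 b k x a + ENNReal.ofReal E ∧
      idealWeight 𝒳 b k x a ≤ w a + ENNReal.ofReal E := by
    intro a
    have h := (le_iSup (fun a => max (w a - idealWeight 𝒳 b k x a)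
      (idealWeight 𝒳 b k x a - w a)) a).trans h1
    rw [max_le_iff] at h
    exact ⟨tsub_le_iff_left.1 h.1, tsub_le_iff_left.1 h.2⟩
  -- The weight error is paid twice: at the quantized source, to go from ideal to actual weights,
  -- and at the minimizer, to return.
  have h4 := linCost_le_add 𝒳 b k w _ _ (fun a => (hd a).1) (quantVec b x) hq
  have h5 := linCost_le_add 𝒳 b k _ w _ (fun a => (hd a).2) v hv.1
  have hneg : norm2 (A.mulVec (quantVec b x) - A.mulVec x) ^ 2 =
      norm2 (A.mulVec (x - quantVec b x)) ^ 2 := by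
    rw [← Matrix.mulVec_sub, norm2_sq, norm2_sq, ← neg_sub x, Matrix.mulVec_neg]
    simp
  have h6 : amepCost 𝒳 b k w lam A (A.mulVec x) v ≤ ENNReal.ofReal (H + G + E) := by
    refine (hv.2 _ hq).trans ?_
    unfold amepCost
    rw [hneg, show H + G + E = H + E + G by ring, ENNReal.ofReal_add (by positivity) hG,
      ENNReal.ofReal_add hH hE]
    exact add_le_add (h4.trans (add_le_add h3 le_rfl)) (ENNReal.ofReal_le_ofReal h2)
  unfold amepCost at h6
  rw [← Matrix.mulVec_sub] at h6
  constructor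
  · refine h5.trans ?_
    rw [show H + G + 2 * E = H + G + E + E by ring, ENNReal.ofReal_add (by positivity) hE]
    exact add_le_add (le_self_add.trans h6) le_rfl
  · have h7 := (ENNReal.ofReal_le_ofReal_iff (by positivity)).1 (le_add_self.trans h6)
    linarith

/-! ### Source and matrix together -/

section Joint

variable {Ω : Type*} [MeasurableSpace Ω] {μ : Measure Ω} [IsProbabilityMeasure μ]
  {X : ℕ → Ω → ℝ} {m n : ℕ} {A : Ω → Matrix (Fin m) (Fin n) ℝ}

theorem measurable_initial (hX : ∀ i, Measurable (X i)) : Measurable (initial X n) :=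
  measurable_pi_lambda _ fun i => hX i

/-- By independence and Tonelli the source can be frozen, and estimates for fixed vectors then apply
to the matrix. -/
theorem lintegral_initial_matrix (hX : ∀ i, Measurable (X i)) (hA : IsStdGaussianMatrix A μ)
    (hAX : IndepFun (initial X n) (fun ω (p : Fin m × Fin n) => A ω p.1 p.2) μ)
    (F : (Fin n → ℝ) × (Fin m × Fin n → ℝ) → ℝ≥0∞) (hF : Measurable F) :
    ∫⁻ ω, F (initial X n ω, fun p => A ω p.1 p.2) ∂μ =
      ∫⁻ ω, ∫⁻ B, F (initial X n ω, B) ∂(gaussianMatrixLaw m n) ∂μ := by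
  have hXm := measurable_initial (n := n) hX
  have hlaw := hA.hasLaw
  have hmap := (indepFun_iff_map_prod_eq_prod_map_map hXm.aemeasurable hlaw.aemeasurable).1 hAX
  rw [hlaw.map_eq] at hmap
  have := Measure.isProbabilityMeasure_map (μ := μ) hXm.aemeasurable
  rw [← lintegral_map' (f := F) (g := fun ω => (initial X n ω, fun p => A ω p.1 p.2))
    hF.aemeasurable (hXm.aemeasurable.prodMk hlaw.aemeasurable), hmap,
    lintegral_prod _ hF.aemeasurable, lintegral_map hF.lintegral_prod_right' hXm]

theorem measurable_quantVec (b : ℕ) : Measurable (quantVec (n := n) b) :=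
  measurable_pi_lambda _ fun i => (measurable_quantize b).comp (measurable_pi_apply i)

/-- Markov's inequality for the measured quantization error. -/
theorem measure_norm2_quantization_error_gt_le (hX : ∀ i, Measurable (X i))
    (hA : IsStdGaussianMatrix A μ)
    (hAX : IndepFun (initial X n) (fun ω (p : Fin m × Fin n) => A ω p.1 p.2) μ)
    (b : ℕ) (t : ℝ) (ht : 0 < t) :
    μ {ω | t < norm2 ((A ω).mulVec (initial X n ω - quantVec b (initial X n ω))) ^ 2} ≤
      ENNReal.ofReal (m * (n * ((4 : ℝ) ^ b)⁻¹) / t) := by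
  set F : (Fin n → ℝ) × (Fin m × Fin n → ℝ) → ℝ≥0∞ := fun p => ENNReal.ofReal
    (norm2 ((Matrix.of fun i j => p.2 (i, j)).mulVec (p.1 - quantVec b p.1)) ^ 2) with hF
  have hFm : Measurable F := by
    refine ENNReal.measurable_ofReal.comp ((measurable_matrix_mulVec m n).comp
      (f := fun p : (Fin n → ℝ) × (Fin m × Fin n → ℝ) => (p.1 - quantVec b p.1, p.2)) ?_)
    exact (measurable_fst.sub ((measurable_quantVec b).comp measurable_fst)).prodMk measurable_snd
  have h1 : ∫⁻ ω, F (initial X n ω, fun p => A ω p.1 p.2) ∂μ ≤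
      ENNReal.ofReal (m * (n * ((4 : ℝ) ^ b)⁻¹)) := by
    rw [lintegral_initial_matrix hX hA hAX F hFm]
    calc _ ≤ ∫⁻ _ω, ENNReal.ofReal (m * (n * ((4 : ℝ) ^ b)⁻¹)) ∂μ := by
          refine lintegral_mono fun ω => ?_
          simp only [hF]
          rw [lintegral_gaussian_mulVec, ENNReal.ofReal_mul (Nat.cast_nonneg m),
            ENNReal.ofReal_natCast]
          gcongr
          exact norm2_sub_quantVec_sq_le b _
      _ = _ := by simp
  have hae : AEMeasurable (fun ω => F (initial X n ω, fun p => A ω p.1 p.2)) μ :=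
    hFm.comp_aemeasurable ((measurable_initial hX).aemeasurable.prodMk hA.hasLaw.aemeasurable)
  have h2 := meas_ge_le_lintegral_div hae (ε := ENNReal.ofReal t)
    (ENNReal.ofReal_pos.2 ht).ne' ENNReal.ofReal_ne_top
  rw [ENNReal.ofReal_div_of_pos ht]
  refine (measure_mono fun ω hω => ?_).trans (h2.trans (ENNReal.div_le_div_right h1 _))
  exact ENNReal.ofReal_le_ofReal (le_of_lt hω)

/-- Union bound: with high probability no sequence of a moderately large, source-dependent
candidate set is far from the source and has a small measured difference from it. -/
theorem measure_exists_far_candidate_le (hX : ∀ i, Measurable (X i)) {𝒳 : Set ℝ}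
    (hX𝒳 : ∀ i ω, X i ω ∈ 𝒳) (hA : IsStdGaussianMatrix A μ)
    (hAX : IndepFun (initial X n) (fun ω (p : Fin m × Fin n) => A ω p.1 p.2) μ)
    (b : ℕ) [Fintype (quantAlphabet 𝒳 b)] (C : (Fin n → ℝ) → (Fin n → quantAlphabet 𝒳 b) → Prop)
    (N : ℝ) (hN : ∀ v, (Nat.card {u // C v u} : ℝ) ≤ N) (s D T : ℝ) (hs : 0 ≤ s) (hD : 0 ≤ D) :
    μ {ω | ∃ u : Fin n → quantAlphabet 𝒳 b, C (quantVec b (initial X n ω)) u ∧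
      D ≤ norm2 ((fun i => (u i : ℝ)) - initial X n ω) ^ 2 ∧
      norm2 ((A ω).mulVec ((fun i => (u i : ℝ)) - initial X n ω)) ^ 2 ≤ T} ≤
      ENNReal.ofReal (N * (Real.exp (s * T) * ((√(1 + 2 * s * D))⁻¹) ^ m)) := by
  classical
  set P := Real.exp (s * T) * ((√(1 + 2 * s * D))⁻¹) ^ m with hP
  have hP0 : 0 ≤ P := by positivity
  set piece : (Fin n → quantAlphabet 𝒳 b) → (Fin n → quantAlphabet 𝒳 b) →
      Set ((Fin n → ℝ) × (Fin m × Fin n → ℝ)) := fun v u =>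
    {p | quantVec b p.1 = fun i => (v i : ℝ)} ∩
      ({p | D ≤ norm2 ((fun i => (u i : ℝ)) - p.1) ^ 2} ∩
      {p | norm2 ((Matrix.of fun i j => p.2 (i, j)).mulVec ((fun i => (u i : ℝ)) - p.1)) ^ 2 ≤ T})
    with hpiece
  -- Splitting over the finitely many values `v` of the quantized source makes the event measurable
  -- although `C` is an arbitrary predicate.
  set S : Set ((Fin n → ℝ) × (Fin m × Fin n → ℝ)) :=
    ⋃ v : Fin n → quantAlphabet 𝒳 b, ⋃ u : {u // C (fun i => (v i : ℝ)) u}, piece v u with hS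
  have hSm : MeasurableSet S := by
    refine MeasurableSet.iUnion fun v => MeasurableSet.iUnion fun u => ?_
    refine MeasurableSet.inter ?_ (MeasurableSet.inter ?_ ?_)
    · exact ((measurable_quantVec b).comp measurable_fst) (measurableSet_singleton _)
    · simp_rw [norm2_sq]
      refine measurableSet_le measurable_const (Finset.measurable_sum _ fun i _ => ?_)
      exact (measurable_const.sub ((measurable_pi_apply i).comp measurable_fst)).pow_const 2
    · refine measurableSet_le ((measurable_matrix_mulVec m n).comp
        (f := fun p : (Fin n → ℝ) × (Fin m × Fin n → ℝ) =>
          ((fun i => ((u : Fin n → quantAlphabet 𝒳 b) i : ℝ)) - p.1, p.2)) ?_) measurable_const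
      exact (measurable_const.sub measurable_fst).prodMk measurable_snd
  -- For a frozen source the candidate set is a fixed finite set, so the union bound over the matrix
  -- law applies.
  have hfib : ∀ ω, gaussianMatrixLaw m n {B | (initial X n ω, B) ∈ S} ≤ ENNReal.ofReal (N * P) := by
    intro ω
    set x := initial X n ω with hx
    set U : Finset (Fin n → quantAlphabet 𝒳 b) :=
      Finset.univ.filter fun u => C (quantVec b x) u ∧ D ≤ norm2 ((fun i => (u i : ℝ)) - x) ^ 2
      with hU
    have hsub : {B | (x, B) ∈ S} ⊆ ⋃ u ∈ U, {B : Fin m × Fin n → ℝ |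
        norm2 ((Matrix.of fun i j => B (i, j)).mulVec ((fun i => (u i : ℝ)) - x)) ^ 2 ≤ T} := by
      intro B hB
      simp only [hS, Set.mem_ofPred_eq, Set.mem_iUnion] at hB
      obtain ⟨v, u, h1, h2, h3⟩ := hB
      simp only [Set.mem_ofPred_eq] at h1 h2 h3
      refine Set.mem_iUnion₂.2 ⟨u.1, ?_, h3⟩
      rw [hU, Finset.mem_filter]
      refine ⟨Finset.mem_univ _, ?_, h2⟩
      rw [h1]
      exact u.2
    have hcard : (U.card : ℝ) ≤ N := by
      refine le_trans ?_ (hN (quantVec b x))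
      rw [Nat.card_eq_fintype_card, Fintype.card_subtype]
      exact_mod_cast Finset.card_le_card fun u hu => by
        rw [hU, Finset.mem_filter] at hu
        rw [Finset.mem_filter]
        exact ⟨hu.1, hu.2.1⟩
    calc gaussianMatrixLaw m n {B | (x, B) ∈ S}
        ≤ ∑ u ∈ U, gaussianMatrixLaw m n {B : Fin m × Fin n → ℝ |
          norm2 ((Matrix.of fun i j => B (i, j)).mulVec ((fun i => (u i : ℝ)) - x)) ^ 2 ≤ T} :=
          (measure_mono hsub).trans (measure_biUnion_finset_le _ _)
      _ ≤ ∑ u ∈ U, ENNReal.ofReal P := Finset.sum_le_sum fun u hu =>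
          gaussian_mulVec_small_ball m n _ s D T hs hD (Finset.mem_filter.1 hu).2.2
      _ = ENNReal.ofReal (U.card * P) := by
          rw [Finset.sum_const, nsmul_eq_mul, ENNReal.ofReal_mul (Nat.cast_nonneg _),
            ENNReal.ofReal_natCast]
      _ ≤ _ := ENNReal.ofReal_le_ofReal (mul_le_mul_of_nonneg_right hcard hP0)
  have hF : Measurable (S.indicator (1 : (Fin n → ℝ) × (Fin m × Fin n → ℝ) → ℝ≥0∞)) := measurable_one.indicator hSm
  have hae : AEMeasurable (fun ω => (initial X n ω, fun p : Fin m × Fin n => A ω p.1 p.2)) μ :=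
    (measurable_initial hX).aemeasurable.prodMk hA.hasLaw.aemeasurable
  calc _ ≤ μ ((fun ω => (initial X n ω, fun p : Fin m × Fin n => A ω p.1 p.2)) ⁻¹' S) := by
        refine measure_mono fun ω hω => ?_
        obtain ⟨u, h1, h2, h3⟩ := hω
        simp only [hS, Set.mem_preimage, Set.mem_iUnion]
        exact ⟨fun i => ⟨quantize b (X i ω), X i ω, hX𝒳 _ _, rfl⟩, ⟨u, h1⟩, rfl, h2, h3⟩
    _ ≤ ∫⁻ ω, S.indicator 1 (initial X n ω, fun p => A ω p.1 p.2) ∂μ := by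
        rw [← Measure.map_apply_of_aemeasurable hae hSm, ← lintegral_indicator_one hSm,
          lintegral_map' hF.aemeasurable hae]
    _ = ∫⁻ ω, gaussianMatrixLaw m n {B | (initial X n ω, B) ∈ S} ∂μ := by
        rw [lintegral_initial_matrix hX hA hAX _ hF]
        refine lintegral_congr fun ω => ?_
        exact lintegral_indicator_one (measurable_prodMk_left (x := initial X n ω) hSm)
    _ ≤ ∫⁻ _ω, ENNReal.ofReal (N * P) ∂μ := lintegral_mono hfib
    _ = _ := by simp

end Joint

/-! ### Growth of the parameters -/

theorem norm2_sub_comm {n : ℕ} (x y : Fin n → ℝ) : norm2 (x - y) = norm2 (y - x) := by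
  unfold norm2
  rw [WithLp.toLp_sub, WithLp.toLp_sub, norm_sub_rev]

theorem tendsto_zero_of_forall_le_ofReal {f : ℕ → ℝ≥0∞}
    (h : ∀ θ : ℝ, 0 < θ → ∀ᶠ n in atTop, f n ≤ ENNReal.ofReal θ) : Tendsto f atTop (𝓝 0) := by
  rw [ENNReal.tendsto_nhds_zero]
  intro ε hε
  by_cases htop : ε = ⊤
  · simp [htop]
  · filter_upwards [h ε.toReal (ENNReal.toReal_pos hε.ne' htop)] with n hn
    rwa [ENNReal.ofReal_toReal htop] at hn

theorem tendsto_logb_natCast : Tendsto (fun n : ℕ => Real.logb 2 n) atTop atTop :=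
  (Real.tendsto_logb_atTop (by norm_num)).comp tendsto_natCast_atTop_atTop

theorem tendsto_logb_logb_natCast :
    Tendsto (fun n : ℕ => Real.logb 2 (Real.logb 2 n)) atTop atTop :=
  (Real.tendsto_logb_atTop (by norm_num)).comp tendsto_logb_natCast

theorem tendsto_bitLevel {r : ℝ} (hr : 0 < r) : Tendsto (bitLevel r) atTop atTop :=
  tendsto_nat_floor_atTop.comp (tendsto_logb_logb_natCast.const_mul_atTop hr)

/-- `λ = 4^(r log₂ log₂ n)`, and rounding the exponent down to `b` loses at most a factor 4. -/
theorem eventually_lagrange_bounds {r : ℝ} (hr : 0 < r) :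
    ∀ᶠ n in atTop, (4 : ℝ) ^ bitLevel r n ≤ lagrange r n ∧
      lagrange r n ≤ 4 * 4 ^ bitLevel r n := by
  filter_upwards [tendsto_logb_natCast.eventually_gt_atTop 0,
    tendsto_logb_logb_natCast.eventually_ge_atTop 0] with n h1 h2
  set y := Real.logb 2 (Real.logb 2 n) with hy
  have hlam : lagrange r n = 4 ^ (r * y) := by
    unfold lagrange
    conv_lhs => rw [← Real.rpow_logb (b := 2) (by norm_num) (by norm_num) h1]
    rw [← Real.rpow_mul (by norm_num), show (4 : ℝ) = 2 ^ (2 : ℝ) by norm_num,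
      ← Real.rpow_mul (by norm_num)]
    congr 1
    ring
  have hry : 0 ≤ r * y := by positivity
  have hb1 : (bitLevel r n : ℝ) ≤ r * y := Nat.floor_le hry
  have hb2 : r * y < bitLevel r n + 1 := Nat.lt_floor_add_one _
  rw [hlam]
  constructor
  · rw [← Real.rpow_natCast]
    exact Real.rpow_le_rpow_of_exponent_le (by norm_num) hb1
  · refine (Real.rpow_le_rpow_of_exponent_le (by norm_num) hb2.le).trans (le_of_eq ?_)
    rw [Real.rpow_add (by norm_num), Real.rpow_natCast, Real.rpow_one, mul_comm]

/-- This is `k = o(n)`, obtained from `log n / log log n ≤ log n = o(n)`; it makes `|𝒳_b|^(k+1)`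
negligible against `2^(bm)`. -/
theorem eventually_order_le {k : ℕ → ℕ}
    (hk : (fun n : ℕ => (k n : ℝ)) =o[atTop]
      fun n : ℕ => Real.logb 2 n / Real.logb 2 (Real.logb 2 n)) {α : ℝ} (hα : 0 < α) :
    ∀ᶠ n : ℕ in atTop, ((k n + 1 : ℕ) : ℝ) ≤ α * n := by
  have hlog2 : 0 < Real.log 2 := Real.log_pos (by norm_num)
  have h1 := (Real.isLittleO_log_id_atTop.comp_tendsto (tendsto_natCast_atTop_atTop (R := ℝ))).def
    (show 0 < α / 2 * Real.log 2 by positivity)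
  filter_upwards [hk.def one_pos, h1, tendsto_logb_natCast.eventually_gt_atTop 0,
    tendsto_logb_logb_natCast.eventually_ge_atTop 1,
    tendsto_natCast_atTop_atTop.eventually_ge_atTop (2 / α)] with n h2 h3 h4 h5 h6
  rw [one_mul, Real.norm_of_nonneg (Nat.cast_nonneg _),
    Real.norm_of_nonneg (by positivity)] at h2
  have h7 : Real.logb 2 n / Real.logb 2 (Real.logb 2 n) ≤ Real.logb 2 n :=
    div_le_self h4.le h5
  have h8 : Real.logb 2 n ≤ α / 2 * n := by
    rw [Real.logb, div_le_iff₀ hlog2]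
    simp only [Function.comp_apply, id_eq, Real.norm_eq_abs] at h3
    calc Real.log n ≤ |Real.log n| := le_abs_self _
      _ ≤ _ := h3
      _ = _ := by rw [abs_of_nonneg (Nat.cast_nonneg n)]; ring
  have h9 : 1 ≤ α / 2 * n := by
    rw [div_le_iff₀ hα] at h6; linarith
  push_cast
  linarith

/-! ### The exceptional events have vanishing probability -/

section Events

variable {Ω : Type*} [MeasurableSpace Ω] {μ : Measure Ω} {X : ℕ → Ω → ℝ}

theorem IsUpperID.exists_condEntropy_le {d : ℝ≥0} (hd : IsUpperID X μ d) {ε : ℝ} (hε : 0 < ε) :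
    ∃ l : ℕ, ∀ᶠ b : ℕ in atTop,
      condEntropy (fun ω => quantize b (X l ω)) (fun ω => quantVec b (initial X l ω)) μ ≤
        ENNReal.ofReal (b * (d + ε)) := by
  have hlt : (d : ℝ≥0∞) < ENNReal.ofReal (d + ε) := by
    rw [← ENNReal.ofReal_coe_nnreal, ENNReal.ofReal_lt_ofReal_iff (by positivity)]
    linarith
  obtain ⟨l, hl⟩ := (hd.eventually_lt_const hlt).exists
  refine ⟨l, ?_⟩
  filter_upwards [eventually_lt_of_limsup_lt hl, eventually_gt_atTop 0] with b hb hb0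
  have h := (ENNReal.div_le_iff (by exact_mod_cast hb0.ne') (by simp)).1 hb.le
  rwa [← ENNReal.ofReal_natCast, ← ENNReal.ofReal_mul (by positivity), mul_comm] at h

variable [IsProbabilityMeasure μ]

/-- The scaled error has mean at most `4m/n`. The extra `√b` in the threshold gives Markov
probability at most `1/√b`, yet keeps the threshold negligible against `b m/n`. -/
theorem tendsto_measure_quantization_error {r : ℝ} (hr : 0 < r) (hX : ∀ i, Measurable (X i))
    {m : ℕ → ℕ} (hm0 : ∀ᶠ n in atTop, 0 < m n) {A : ∀ n, Ω → Matrix (Fin (m n)) (Fin n) ℝ}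
    (hA : ∀ n, IsStdGaussianMatrix (A n) μ)
    (hAX : ∀ n, IndepFun (initial X n) (fun ω (p : Fin (m n) × Fin n) => A n ω p.1 p.2) μ) :
    Tendsto (fun n => μ {ω | 4 * √(bitLevel r n : ℝ) * m n / n < lagrange r n / (n : ℝ) ^ 2 *
      norm2 ((A n ω).mulVec (initial X n ω - quantVec (bitLevel r n) (initial X n ω))) ^ 2})
      atTop (𝓝 0) := by
  have hb := tendsto_bitLevel hr
  have hlim : Tendsto (fun n => ENNReal.ofReal (√(bitLevel r n : ℝ))⁻¹) atTop (𝓝 0) := by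
    rw [← ENNReal.ofReal_zero]
    refine ENNReal.tendsto_ofReal (tendsto_inv_atTop_zero.comp ?_)
    exact Real.tendsto_sqrt_atTop.comp (tendsto_natCast_atTop_atTop.comp hb)
  refine tendsto_of_tendsto_of_tendsto_of_le_of_le' tendsto_const_nhds hlim
    (Eventually.of_forall fun _ => zero_le) ?_
  filter_upwards [hm0, eventually_gt_atTop 0, hb.eventually_gt_atTop 0,
    eventually_lagrange_bounds hr] with n hm hn hbn hlam
  set b := bitLevel r n
  have hm' : (0 : ℝ) < m n := by exact_mod_cast hm
  have hn' : (0 : ℝ) < n := by exact_mod_cast hn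
  have hb' : (0 : ℝ) < √(b : ℝ) := Real.sqrt_pos.2 (by exact_mod_cast hbn)
  have h4 : (0 : ℝ) < 4 ^ b := by positivity
  have hlam0 : 0 < lagrange r n := h4.trans_le hlam.1
  set t := 4 * √(b : ℝ) * m n / n * ((n : ℝ) ^ 2 / lagrange r n) with ht
  have ht0 : 0 < t := by positivity
  refine (measure_mono fun ω hω => ?_).trans
    ((measure_norm2_quantization_error_gt_le hX (hA n) (hAX n) b t ht0).trans
      (ENNReal.ofReal_le_ofReal ?_))
  · simp only [Set.mem_ofPred_eq] at hω ⊢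
    rw [ht, ← lt_div_iff₀ (by positivity)]
    refine hω.trans_le (le_of_eq ?_)
    field_simp
  · rw [div_le_iff₀ ht0, ht]
    have h5 : (√(b : ℝ))⁻¹ * (4 * √(b : ℝ) * m n / n * ((n : ℝ) ^ 2 / lagrange r n)) =
        4 * m n * n / lagrange r n := by field_simp
    rw [h5, le_div_iff₀ hlam0]
    have h6 : (m n : ℝ) * (n * ((4 : ℝ) ^ b)⁻¹) * lagrange r n ≤
        m n * (n * ((4 : ℝ) ^ b)⁻¹) * (4 * 4 ^ b) := by
      gcongr; exact hlam.2
    refine h6.trans (le_of_eq ?_)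
    field_simp

/-- One `ε` each is spent on the entropy of fixed order `l`, on the extra smoothing bit (`1 ≤ εb`),
and on the deviation in the weak law. Code lengths and the allowed deviation are both of order `b`,
so the Chebyshev ratio does not grow with `b`. -/
theorem tendsto_measure_idealWeight_cost {𝒳 : Set ℝ} (hX𝒳 : ∀ i ω, X i ω ∈ 𝒳)
    [∀ b, Finite (quantAlphabet 𝒳 b)] {K : ℝ}
    (hK : ∀ b, (Nat.card (quantAlphabet 𝒳 b) : ℝ) ≤ K * 2 ^ b)
    (hX : ∀ i, Measurable (X i)) (hstat : IsStationary X μ) (hmix : IsPsiStarMixing X μ)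
    {d : ℝ≥0} (hd : IsUpperID X μ d) {r : ℝ} (hr : 0 < r) {k : ℕ → ℕ}
    (hk : Tendsto k atTop atTop)
    (hk' : ∀ α : ℝ, 0 < α → ∀ᶠ n : ℕ in atTop, ((k n + 1 : ℕ) : ℝ) ≤ α * n) {ε : ℝ} (hε : 0 < ε) :
    Tendsto (fun n => μ {ω | ¬ linCost 𝒳 (bitLevel r n) (k n)
      (idealWeight 𝒳 (bitLevel r n) (k n) (initial X n ω))
      (quantVec (bitLevel r n) (initial X n ω)) ≤
        ENNReal.ofReal (bitLevel r n * (d + 3 * ε))}) atTop (𝓝 0) := by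
  have hb := tendsto_bitLevel hr
  obtain ⟨l, hl⟩ := hd.exists_condEntropy_le hε
  refine tendsto_zero_of_forall_le_ofReal fun θ hθ => ?_
  -- Chosen so that `2η · 9b² = θ (εb)²`: mixing and close pairs contribute one `η` each, and `L² ≤
  -- 9b²`.
  set η := θ * ε ^ 2 / 18 with hη
  have hη0 : 0 < η := by positivity
  obtain ⟨g, hg⟩ := (hmix.eventually_lt_const (u := ENNReal.ofReal (1 + η))
    (by rw [← ENNReal.ofReal_one, ENNReal.ofReal_lt_ofReal_iff (by positivity)]; linarith)).exists
  set C : ℝ := 2 * ((l + 1 : ℕ) + g) with hC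
  have hC0 : 0 < C := by positivity
  have hbR : Tendsto (fun n => (bitLevel r n : ℝ)) atTop atTop :=
    tendsto_natCast_atTop_atTop.comp hb
  filter_upwards [hb.eventually hl, hk.eventually_ge_atTop l, hk' (1 / 2) (by norm_num),
    hbR.eventually_ge_atTop 1, hbR.eventually_ge_atTop (1 / ε),
    ((tendsto_pow_atTop_atTop_of_one_lt (r := (2 : ℝ)) (by norm_num)).comp hb).eventually_ge_atTop K,
    tendsto_natCast_atTop_atTop.eventually_ge_atTop (2 * C / η),
    eventually_gt_atTop 0] with n hent hlk hkn hb1 hbε hKb hnC hn0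
  set b := bitLevel r n
  have := Fintype.ofFinite (quantAlphabet 𝒳 b)
  have hn0' : (0 : ℝ) < n := by exact_mod_cast hn0
  have hkn' : k n + 1 < n := by
    have : ((k n + 1 : ℕ) : ℝ) < n := by linarith
    exact_mod_cast this
  have hM : (n : ℝ) / 2 ≤ ((n - (k n + 1) : ℕ) : ℝ) := by
    rw [Nat.cast_sub hkn'.le]; linarith
  have hM0 : (0 : ℝ) < ((n - (k n + 1) : ℕ) : ℝ) := by linarith
  have hb0 : (0 : ℝ) < b := by linarith
  have hbe : 1 ≤ ε * b := by
    rw [div_le_iff₀ hε] at hbε; linarith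
  set L := 1 + Real.logb 2 (Fintype.card (quantAlphabet 𝒳 b)) with hL
  have hlog0 : 0 ≤ Real.logb 2 (Fintype.card (quantAlphabet 𝒳 b)) :=
    div_nonneg (Real.log_natCast_nonneg _) (Real.log_nonneg (by norm_num))
  have hL3 : L ≤ 3 * b := by
    rcases Nat.eq_zero_or_pos (Fintype.card (quantAlphabet 𝒳 b)) with h0 | h0
    · rw [hL, h0]; simp; linarith
    · have h1 : (Fintype.card (quantAlphabet 𝒳 b) : ℝ) ≤ 2 ^ (2 * (b : ℝ)) := by
        rw [← Nat.card_eq_fintype_card]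
        refine (hK b).trans ?_
        have h2 : K * 2 ^ b ≤ (2 : ℝ) ^ b * 2 ^ b :=
          mul_le_mul_of_nonneg_right hKb (by positivity)
        refine h2.trans (le_of_eq ?_)
        rw [two_mul, Real.rpow_add (by norm_num), Real.rpow_natCast]
      have h3 := Real.logb_le_logb_of_le (b := 2) (by norm_num) (by exact_mod_cast h0) h1
      rw [Real.logb_rpow (by norm_num) (by norm_num)] at h3
      linarith
  have hL2 : L ^ 2 ≤ 9 * (b : ℝ) ^ 2 := by
    have : L ^ 2 ≤ (3 * b) ^ 2 := pow_le_pow_left₀ (by positivity) hL3 2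
    linarith
  have hmain := measure_linCost_idealWeight_gt_le (μ := μ) hX𝒳 hX hstat hη0.le hg.le b l (k n) n
    hlk hkn' (b * (d + ε)) (by positivity) hent (ε * b) (by positivity) L hL
  refine le_trans (measure_mono ?_) (hmain.trans (ENNReal.ofReal_le_ofReal ?_))
  · intro ω hω
    simp only [Set.mem_ofPred_eq] at hω ⊢
    refine fun hle => hω (hle.trans (ENNReal.ofReal_le_ofReal ?_))
    nlinarith
  · rw [div_le_iff₀ (by positivity), ← hC]
    have hCM : C / ((n - (k n + 1) : ℕ) : ℝ) ≤ η := by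
      rw [div_le_iff₀ hM0]
      rw [div_le_iff₀ hη0] at hnC
      nlinarith
    calc η * L ^ 2 + C * L ^ 2 / ((n - (k n + 1) : ℕ) : ℝ)
        = (η + C / ((n - (k n + 1) : ℕ) : ℝ)) * L ^ 2 := by ring
      _ ≤ (η + η) * (9 * (b : ℝ) ^ 2) := by gcongr
      _ = θ * (ε * b) ^ 2 := by rw [hη]; ring

/-- The exponents in the union bound over candidates. -/
theorem candidate_exponent_bound {n b k m : ℕ} (hn : 0 < n) (hb : 0 < b) {N R τ γ : ℝ} (hτ : 0 < τ)
    (hN0 : 0 ≤ N) (hN : N ≤ 4 ^ b) (hk : ((k + 1 : ℕ) : ℝ) ≤ γ * m / 2)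
    (hR : n * R ≤ m * b * (1 - 4 * γ)) (hbτ : 2 * √(b : ℝ) ≤ τ * 2 ^ (2 * γ * b)) :
    N ^ (k + 1) * 2 ^ (n * R) * (Real.exp (4 ^ b / (2 * b * n) * (n * m * b / 4 ^ b)) *
      ((√(1 + 2 * (4 ^ b / (2 * b * n)) * (n * τ ^ 2)))⁻¹) ^ m) ≤ 2 ^ (-(γ * b * m)) := by
  have hn' : (0 : ℝ) < n := by exact_mod_cast hn
  have hb' : (0 : ℝ) < b := by exact_mod_cast hb
  have hsb : 0 < √(b : ℝ) := Real.sqrt_pos.2 hb'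
  have h1 : N ^ (k + 1) ≤ 2 ^ (γ * b * m) := by
    calc N ^ (k + 1) ≤ ((4 : ℝ) ^ b) ^ (k + 1) := pow_le_pow_left₀ hN0 hN _
      _ = 2 ^ (2 * (b : ℝ) * ((k + 1 : ℕ) : ℝ)) := by
        rw [Real.rpow_mul (by norm_num), Real.rpow_mul (by norm_num), Real.rpow_natCast,
          Real.rpow_natCast]
        norm_num
      _ ≤ 2 ^ (γ * b * m) := by
        refine Real.rpow_le_rpow_of_exponent_le (by norm_num) ?_
        nlinarith
  have h2 : (2 : ℝ) ^ (n * R) ≤ 2 ^ (m * b * (1 - 4 * γ)) :=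
    Real.rpow_le_rpow_of_exponent_le (by norm_num) hR
  -- The exponent is `m/2`, and `√e ≤ 2`.
  have h3 : Real.exp (4 ^ b / (2 * b * n) * (n * m * b / 4 ^ b)) ≤ 2 ^ m := by
    have e : (4 : ℝ) ^ b / (2 * b * n) * (n * m * b / 4 ^ b) = m * (1 / 2) := by field_simp
    rw [e, Real.exp_nat_mul]
    refine pow_le_pow_left₀ (Real.exp_pos _).le ?_ m
    have h4 : Real.exp (1 / 2) ^ 2 ≤ 2 ^ 2 := by
      rw [← Real.exp_nat_mul]
      norm_num
      linarith [Real.exp_one_lt_d9]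
    exact (pow_le_pow_iff_left₀ (Real.exp_pos _).le (by norm_num) two_ne_zero).1 h4
  have h5 : (√(1 + 2 * (4 ^ b / (2 * b * n)) * (n * τ ^ 2)))⁻¹ ≤ √(b : ℝ) / (τ * 2 ^ b) := by
    rw [← inv_div (τ * 2 ^ b) √(b : ℝ)]
    refine inv_anti₀ (by positivity) (Real.le_sqrt_of_sq_le ?_)
    have e : (τ * 2 ^ b / √(b : ℝ)) ^ 2 = 2 * (4 ^ b / (2 * b * n)) * (n * τ ^ 2) := by
      rw [div_pow, mul_pow, Real.sq_sqrt hb'.le, ← pow_mul, mul_comm b 2, pow_mul]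
      field_simp
      norm_num
    linarith
  -- The polynomial factor `√b` and the constants, including the 2 from `h3`, are absorbed by
  -- `2^(2γb)`. In total `γ` pays for the context factor, `2γ` for this, and one of the four in `hR`
  -- remains.
  have h6 : 2 * (√(b : ℝ) / (τ * 2 ^ b)) ≤ 2 ^ (2 * γ * b - b) := by
    rw [Real.rpow_sub (by norm_num), Real.rpow_natCast, ← mul_div_assoc, div_le_div_iff₀
      (by positivity) (by positivity)]
    calc 2 * √(b : ℝ) * 2 ^ b ≤ τ * 2 ^ (2 * γ * b) * 2 ^ b := by gcongr
      _ = _ := by ring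
  calc N ^ (k + 1) * 2 ^ (n * R) * (Real.exp (4 ^ b / (2 * b * n) * (n * m * b / 4 ^ b)) *
        ((√(1 + 2 * (4 ^ b / (2 * b * n)) * (n * τ ^ 2)))⁻¹) ^ m)
      ≤ 2 ^ (γ * b * m) * 2 ^ (m * b * (1 - 4 * γ)) *
        (2 ^ m * (√(b : ℝ) / (τ * 2 ^ b)) ^ m) := by gcongr
    _ = 2 ^ (γ * b * m) * 2 ^ (m * b * (1 - 4 * γ)) * (2 * (√(b : ℝ) / (τ * 2 ^ b))) ^ m := by
        rw [mul_pow 2]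
    _ ≤ 2 ^ (γ * b * m) * 2 ^ (m * b * (1 - 4 * γ)) * (2 ^ (2 * γ * b - b)) ^ m := by gcongr
    _ = 2 ^ (-(γ * b * m)) := by
        rw [← Real.rpow_mul_natCast (by norm_num), ← Real.rpow_add (by norm_num),
          ← Real.rpow_add (by norm_num)]
        congr 1
        ring

theorem eventually_two_mul_sqrt_le {τ γ : ℝ} (hτ : 0 < τ) (hγ : 0 < γ) :
    ∀ᶠ b : ℕ in atTop, 2 * √(b : ℝ) ≤ τ * 2 ^ (2 * γ * b) := by
  have h := (isLittleO_pow_exp_pos_mul_atTop 1 (show 0 < 2 * γ * Real.log 2 by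
    have := Real.log_pos (show (1 : ℝ) < 2 by norm_num); positivity)).def
    (show 0 < τ / 2 by positivity)
  filter_upwards [tendsto_natCast_atTop_atTop.eventually h, eventually_ge_atTop 1] with b hb hb1
  have hb1' : (1 : ℝ) ≤ b := by exact_mod_cast hb1
  have h2 : √(b : ℝ) ≤ b := by
    rw [Real.sqrt_le_left (by linarith)]
    nlinarith
  rw [pow_one, Real.norm_of_nonneg (by linarith), Real.norm_of_nonneg (Real.exp_pos _).le] at hb
  have h3 : Real.exp (2 * γ * Real.log 2 * b) = 2 ^ (2 * γ * b) := by
    rw [Real.rpow_def_of_pos (by norm_num)]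
    congr 1; ring
  rw [h3] at hb
  linarith

theorem tendsto_measure_far_candidate {𝒳 : Set ℝ} (hX𝒳 : ∀ i ω, X i ω ∈ 𝒳)
    [∀ b, Finite (quantAlphabet 𝒳 b)] {K : ℝ}
    (hK : ∀ b, (Nat.card (quantAlphabet 𝒳 b) : ℝ) ≤ K * 2 ^ b)
    (hX : ∀ i, Measurable (X i)) {r : ℝ} (hr : 0 < r) {k : ℕ → ℕ}
    (hk' : ∀ α : ℝ, 0 < α → ∀ᶠ n : ℕ in atTop, ((k n + 1 : ℕ) : ℝ) ≤ α * n)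
    {m : ℕ → ℕ} {κ : ℝ} (hκ : 0 < κ) (hm : ∀ᶠ n : ℕ in atTop, κ * n ≤ m n)
    {A : ∀ n, Ω → Matrix (Fin (m n)) (Fin n) ℝ} (hA : ∀ n, IsStdGaussianMatrix (A n) μ)
    (hAX : ∀ n, IndepFun (initial X n) (fun ω (p : Fin (m n) × Fin n) => A n ω p.1 p.2) μ)
    {γ τ : ℝ} (hγ : 0 < γ) (hτ : 0 < τ) (R : ℕ → ℝ) (hR0 : ∀ n, 0 ≤ R n)
    (hR : ∀ᶠ n : ℕ in atTop, n * R n ≤ m n * bitLevel r n * (1 - 4 * γ)) :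
    Tendsto (fun n => μ {ω | ∃ u : Fin n → quantAlphabet 𝒳 (bitLevel r n),
      linCost 𝒳 (bitLevel r n) (k n) (idealWeight 𝒳 (bitLevel r n) (k n) (initial X n ω))
        (fun i => (u i : ℝ)) ≤ ENNReal.ofReal (R n) ∧
      n * τ ^ 2 ≤ norm2 ((fun i => (u i : ℝ)) - initial X n ω) ^ 2 ∧
      lagrange r n / (n : ℝ) ^ 2 *
        norm2 ((A n ω).mulVec ((fun i => (u i : ℝ)) - initial X n ω)) ^ 2 ≤ R n})
      atTop (𝓝 0) := by
  have hb := tendsto_bitLevel hr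
  have hbR : Tendsto (fun n => (bitLevel r n : ℝ)) atTop atTop :=
    tendsto_natCast_atTop_atTop.comp hb
  have hlim : Tendsto (fun n => ENNReal.ofReal (2 ^ (-(γ * bitLevel r n)))) atTop (𝓝 0) := by
    rw [← ENNReal.ofReal_zero]
    refine ENNReal.tendsto_ofReal ?_
    have h1 : Tendsto (fun n => -(γ * (bitLevel r n : ℝ))) atTop atBot :=
      tendsto_neg_atTop_atBot.comp (hbR.const_mul_atTop hγ)
    simp only [Real.rpow_def_of_pos (show (0 : ℝ) < 2 by norm_num)]
    exact Real.tendsto_exp_atBot.comp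
      (h1.const_mul_atBot (Real.log_pos (show (1 : ℝ) < 2 by norm_num)))
  refine tendsto_of_tendsto_of_tendsto_of_le_of_le' tendsto_const_nhds hlim
    (Eventually.of_forall fun _ => zero_le) ?_
  filter_upwards [hR, hm, eventually_gt_atTop 0, hb.eventually_gt_atTop 0,
    hk' (γ * κ / 2) (by positivity), hk' 1 one_pos, hb.eventually (eventually_two_mul_sqrt_le hτ hγ),
    ((tendsto_pow_atTop_atTop_of_one_lt (r := (2 : ℝ)) (by norm_num)).comp hb).eventually_ge_atTop K,
    eventually_lagrange_bounds hr] with n hRn hmn hn hbn hkn hkn1 hbτ hKb hlam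
  set b := bitLevel r n
  have := Fintype.ofFinite (quantAlphabet 𝒳 b)
  have hn' : (0 : ℝ) < n := by exact_mod_cast hn
  have hb' : (0 : ℝ) < b := by exact_mod_cast hbn
  have hm' : (0 : ℝ) < m n := lt_of_lt_of_le (by positivity) hmn
  have hm1 : (1 : ℝ) ≤ m n := by exact_mod_cast Nat.cast_pos.1 hm'
  have hk1 : k n + 1 ≤ n := by
    rw [one_mul] at hkn1; exact_mod_cast hkn1
  have hlam0 : 0 < lagrange r n := lt_of_lt_of_le (by positivity) hlam.1
  have hcard : (Fintype.card (quantAlphabet 𝒳 b) : ℝ) ≤ 4 ^ b := by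
    rw [← Nat.card_eq_fintype_card]
    refine (hK b).trans ?_
    calc K * 2 ^ b ≤ (2 : ℝ) ^ b * 2 ^ b := mul_le_mul_of_nonneg_right hKb (by positivity)
      _ = 4 ^ b := by rw [← mul_pow]; norm_num
  have hR1 : n * R n ≤ m n * b := by
    refine hRn.trans (mul_le_of_le_one_right (by positivity) (by linarith))
  have hmain := measure_exists_far_candidate_le (μ := μ) hX hX𝒳 (hA n) (hAX n) b
    (fun v u => linCost 𝒳 b (k n) (fun a => empWeight (k n) v (fun t => (a t : ℝ)))
      (fun i => (u i : ℝ)) ≤ ENNReal.ofReal (R n)) _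
    (fun v => card_linCost_le 𝒳 b (k n) v hk1 (R n) (hR0 n))
    -- A penalty at most `R n`, with `λ ≥ 4^b` and `n R n ≤ m b`, forces the squared residual below
    -- `n m b / 4^b`. The Chernoff parameter makes its product with this threshold equal to `m/2`.
    (4 ^ b / (2 * b * n)) (n * τ ^ 2) (n * m n * b / 4 ^ b) (by positivity) (by positivity)
  refine (measure_mono fun ω hω => ?_).trans (hmain.trans (ENNReal.ofReal_le_ofReal
    ((candidate_exponent_bound hn hbn hτ (Nat.cast_nonneg _) hcard ?_ hRn hbτ).trans ?_)))
  · obtain ⟨u, h1, h2, h3⟩ := hω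
    refine ⟨u, h1, h2, ?_⟩
    rw [le_div_iff₀ (by positivity)]
    set Q := norm2 ((A n ω).mulVec ((fun i => (u i : ℝ)) - initial X n ω)) ^ 2 with hQ
    have hQ0 : 0 ≤ Q := by positivity
    have h4 : lagrange r n * Q ≤ R n * (n : ℝ) ^ 2 := by
      rwa [div_mul_eq_mul_div, div_le_iff₀ (by positivity)] at h3
    calc Q * 4 ^ b ≤ lagrange r n * Q := by
          rw [mul_comm]; exact mul_le_mul_of_nonneg_right hlam.1 hQ0
      _ ≤ R n * (n : ℝ) ^ 2 := h4
      _ = n * (n * R n) := by ring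
      _ ≤ n * (m n * b) := by gcongr
      _ = _ := by ring
  · nlinarith
  · refine Real.rpow_le_rpow_of_exponent_le (by norm_num) (neg_le_neg ?_)
    exact le_mul_of_one_le_right (by positivity) hm1

end Events

end

end AMEP

/-! ### Assembly of the recovery theorem -/

theorem mainTheorem3 {Ω : Type*} [MeasurableSpace Ω] (μ : Measure Ω) [IsProbabilityMeasure μ]
    -- the source: stationary, `Ψ*`-mixing, with a bounded alphabet
    (𝒳 : Set ℝ) (h𝒳 : Bornology.IsBounded 𝒳)
    (X : ℕ → Ω → ℝ) (hXmeas : ∀ i, Measurable (X i)) (hX𝒳 : ∀ i ω, X i ω ∈ 𝒳)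
    (hstat : AMEP.IsStationary X μ) (hmix : AMEP.IsPsiStarMixing X μ)
    (d : ℝ≥0) (hd : AMEP.IsUpperID X μ d)
    -- the parameters
    (r : ℝ) (hr : 1 < r) (δ : ℝ) (hδ : 0 < δ)
    (k : ℕ → ℕ) (hk : Tendsto k atTop atTop)
    (hk' : (fun n : ℕ => (k n : ℝ)) =o[atTop]
      fun n : ℕ => Real.logb 2 n / Real.logb 2 (Real.logb 2 n))
    (m : ℕ → ℕ) (hm : ∀ᶠ n : ℕ in atTop, (1 + δ) * (d : ℝ) * (n : ℝ) ≤ (m n : ℝ))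
    -- positive sampling rate; automatic when `d > 0`
    (c : ℝ) (hc : 0 < c) (hmc : ∀ᶠ n : ℕ in atTop, c * (n : ℝ) ≤ (m n : ℝ))
    -- the measurement matrices
    (A : ∀ n, Ω → Matrix (Fin (m n)) (Fin n) ℝ)
    (hA : ∀ n, AMEP.IsStdGaussianMatrix (A n) μ)
    (hAX : ∀ n, IndepFun (AMEP.initial X n)
      (fun ω (p : Fin (m n) × Fin n) => A n ω p.1 p.2) μ)
    -- the weights used by the decoder; they may depend on the source and on the matrices
    (W : ∀ n, Ω → (Fin (k n + 1) → AMEP.quantAlphabet 𝒳 (AMEP.bitLevel r n)) → ℝ≥0∞)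
    (hW : ∀ ε : ℝ, 0 < ε → Tendsto (fun n => μ {ω | ENNReal.ofReal ε <
        AMEP.weightDist (W n ω)
          (AMEP.idealWeight 𝒳 (AMEP.bitLevel r n) (k n) (AMEP.initial X n ω)) /
        (AMEP.bitLevel r n : ℝ≥0∞)}) atTop (𝓝 0))
    -- the reconstruction from `Y^m = A X^n`
    (Xhat : ∀ n, Ω → (Fin n → ℝ))
    (hXhat : ∀ n ω, AMEP.IsAMEPMinimizer 𝒳 (AMEP.bitLevel r n) (k n) (W n ω)
      (AMEP.lagrange r n) (A n ω) ((A n ω).mulVec (AMEP.initial X n ω)) (Xhat n ω)) :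
    TendstoInMeasure μ
      (fun (n : ℕ) ω => 1 / Real.sqrt (n : ℝ) * AMEP.norm2 (AMEP.initial X n ω - Xhat n ω))
      atTop (fun _ => (0 : ℝ)) := by
  obtain ⟨K, -, hK⟩ := AMEP.exists_card_quantAlphabet_le h𝒳
  have hfin : ∀ b, Finite (AMEP.quantAlphabet 𝒳 b) := fun b => (hK b).1.to_subtype
  have hcard : ∀ b, (Nat.card (AMEP.quantAlphabet 𝒳 b) : ℝ) ≤ K * 2 ^ b := fun b => by
    rw [Nat.card_coe_set_eq]; exact (hK b).2
  have hr0 : 0 < r := by linarith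
  -- The effective sampling rate exceeds `d` strictly in both cases: by the factor `1 + δ` if `d >
  -- 0`, through `c` if `d = 0`.
  set κ : ℝ := max ((1 + δ) * d) c with hκdef
  have hκ0 : 0 < κ := lt_max_of_lt_right hc
  have hdκ : (d : ℝ) < κ := by
    rcases d.2.eq_or_lt with h | h
    · rw [show (d : ℝ) = 0 from h.symm]; exact hκ0
    · exact lt_max_of_lt_left (by nlinarith [show (0 : ℝ) < d from h])
  have hmκ : ∀ᶠ n : ℕ in atTop, κ * n ≤ m n := by
    filter_upwards [hm, hmc] with n h1 h2
    rw [hκdef, max_mul_of_nonneg _ _ (Nat.cast_nonneg n)]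
    exact max_le h1 h2
  have hm0 : ∀ᶠ n in atTop, 0 < m n := by
    filter_upwards [hmκ, eventually_gt_atTop 0] with n h1 h2
    have h3 : (0 : ℝ) < n := by exact_mod_cast h2
    exact_mod_cast lt_of_lt_of_le (mul_pos hκ0 h3) h1
  -- Thus `d + 5ε = κ - 5ε = κ (1 - 5γ)` with `γ = ε/κ`. The cost bound uses `3ε` for the source and
  -- `2ε` for the weights; the residual `4√b m/n` takes one further `γ`, leaving `1 - 4γ`.
  set ε : ℝ := (κ - d) / 10 with hε
  have hε0 : 0 < ε := by rw [hε]; linarith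
  set γ : ℝ := ε / κ with hγ
  have hγ0 : 0 < γ := by positivity
  have hkα : ∀ α : ℝ, 0 < α → ∀ᶠ n : ℕ in atTop, ((k n + 1 : ℕ) : ℝ) ≤ α * n :=
    fun α hα => AMEP.eventually_order_le hk' hα
  have hb := AMEP.tendsto_bitLevel hr0
  set G : ℕ → ℝ := fun n => 4 * √(AMEP.bitLevel r n : ℝ) * m n / n with hG
  set R : ℕ → ℝ := fun n => AMEP.bitLevel r n * (d + 3 * ε) + G n + 2 * (ε * AMEP.bitLevel r n)
    with hRdef
  have hG0 : ∀ n, 0 ≤ G n := fun n => by positivity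
  have hR0 : ∀ n, 0 ≤ R n := fun n => by
    have := hG0 n
    positivity
  have hR : ∀ᶠ n : ℕ in atTop, n * R n ≤ m n * AMEP.bitLevel r n * (1 - 4 * γ) := by
    filter_upwards [hmκ, eventually_gt_atTop 0, (Real.tendsto_sqrt_atTop.comp
      (tendsto_natCast_atTop_atTop.comp hb)).eventually_ge_atTop (4 / γ)] with n h1 h2 h3
    have hn : (0 : ℝ) < n := by exact_mod_cast h2
    simp only [Function.comp_apply] at h3
    set b : ℝ := (AMEP.bitLevel r n : ℝ) with hbdef
    have hb0 : 0 ≤ b := Nat.cast_nonneg _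
    have h4 : 4 * √b ≤ γ * b := by
      rw [div_le_iff₀ hγ0] at h3
      nlinarith [Real.mul_self_sqrt hb0, Real.sqrt_nonneg b]
    have h5 : n * R n = n * (κ - 5 * ε) * b + 4 * √b * m n := by
      have : (d : ℝ) = κ - 10 * ε := by rw [hε]; ring
      simp only [hRdef, hG, ← hbdef]
      rw [this]
      field_simp
      ring
    have h6 : (n : ℝ) * (κ - 5 * ε) ≤ m n * (1 - 5 * γ) := by
      have h7 : κ - 5 * ε = κ * (1 - 5 * γ) := by rw [hγ]; field_simp
      have h8 : 0 ≤ 1 - 5 * γ := by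
        rw [hγ, sub_nonneg, ← mul_div_assoc, div_le_one hκ0, hε]
        linarith [d.2, show (0 : ℝ) ≤ d from d.2]
      rw [h7]
      nlinarith
    have h9 : (0 : ℝ) ≤ m n := Nat.cast_nonneg _
    nlinarith [mul_le_mul_of_nonneg_right h6 hb0, mul_le_mul_of_nonneg_right h4 h9]
  rw [tendstoInMeasure_iff_dist]
  intro τ hτ
  have t1 := hW ε hε0
  have t2 := AMEP.tendsto_measure_quantization_error (μ := μ) hr0 hXmeas hm0 hA hAX
  have t3 := AMEP.tendsto_measure_idealWeight_cost hX𝒳 hcard hXmeas hstat hmix hd hr0 hk hkα hε0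
  have t4 := AMEP.tendsto_measure_far_candidate (μ := μ) hX𝒳 hcard hXmeas hr0 hkα hκ0 hmκ hA hAX
    hγ0 hτ R hR0 hR
  have t := ((t1.add t2).add t3).add t4
  simp only [add_zero] at t
  refine tendsto_of_tendsto_of_tendsto_of_le_of_le' tendsto_const_nhds t
    (Eventually.of_forall fun _ => zero_le) ?_
  filter_upwards [eventually_gt_atTop 0, hb.eventually_gt_atTop 0] with n hn hbn
  have hn' : (0 : ℝ) < n := by exact_mod_cast hn
  -- Monotonicity and subadditivity hold for arbitrary sets, so neither the weights nor the
  -- minimizer need be measurable.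
  refine le_trans (measure_mono ?_) ((measure_union_le _ _).trans (add_le_add
    ((measure_union_le _ _).trans (add_le_add (measure_union_le _ _) le_rfl)) le_rfl))
  intro ω hω
  simp only [Set.mem_union, Set.mem_ofPred_eq] at hω ⊢
  by_contra hcon
  push Not at hcon
  obtain ⟨⟨⟨h1, h2⟩, h3⟩, h4⟩ := hcon
  have hfar : n * τ ^ 2 ≤ AMEP.norm2 (Xhat n ω - AMEP.initial X n ω) ^ 2 := by
    rw [Real.dist_eq, sub_zero, abs_of_nonneg (mul_nonneg (by positivity) (AMEP.norm2_nonneg _)),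
      one_div, ← div_eq_inv_mul, le_div_iff₀ (Real.sqrt_pos.2 hn'), AMEP.norm2_sub_comm] at hω
    calc (n : ℝ) * τ ^ 2 = (τ * √n) ^ 2 := by rw [mul_pow, Real.sq_sqrt hn'.le]; ring
      _ ≤ _ := pow_le_pow_left₀ (by positivity) hω 2
  have hwd : AMEP.weightDist (W n ω) (AMEP.idealWeight 𝒳 (AMEP.bitLevel r n) (k n)
      (AMEP.initial X n ω)) ≤ ENNReal.ofReal (ε * AMEP.bitLevel r n) := by
    rw [ENNReal.ofReal_mul hε0.le, ENNReal.ofReal_natCast]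
    exact (ENNReal.div_le_iff (by exact_mod_cast hbn.ne') (by simp)).1 h1
  obtain ⟨h5, h6⟩ := (hXhat n ω).cost_bounds (fun i => hX𝒳 i ω)
    (show 0 ≤ ε * (AMEP.bitLevel r n : ℝ) by positivity) (hG0 n) (by positivity) hwd h2 h3
  -- Off the first three events the minimizer is a candidate with penalty at most `R n`; being far
  -- from the source, it would witness the fourth.
  exact absurd h6 (not_le.2 (h4 (fun i => ⟨Xhat n ω i, (hXhat n ω).1 i⟩) h5 hfar))
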